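/- Let $0<q<1$. For $n\ge 0$ let $\Lambda_n:=\{\lambda\in\mathbb{Z}^n\mid \lambda_1\ge\lambda_2\ge\cdots\ge\lambda_n\}$ (with $\Lambda_0$ a single point), let $\mathcal{F}(\Lambda_n)$ be the space of all functions $f:\Lambda_n\to\mathbb{C}$, and let $\mathcal{F}:=\bigoplus_{n\ge 0}\mathcal{F}(\Lambda_n)$ (algebraic direct sum). For $l\in\mathbb{Z}$ let $m_l(\lambda)$ be the number of components of $\lambda$ equal to $l$, let $\beta_l^*\lambda$ be obtained from $\lambda$ by inserting a component $l$ and, if $m_l(\lambda)>0$, let $\beta_l\lambda$ be obtained by deleting a component $l$. Put $[m]:=\frac{1-q^m}{1-q}$, $[m]!:=[m][m-1]\cdots[1]$ (with $[0]!:=1$), and define linear operators on $\mathcal{F}$ by letting, for $f\in\mathcal{F}(\Lambda_n)$, $\beta_lf\in\mathcal{F}(\Lambda_{n-1})$ be $(\beta_l f)(\lambda):=f(\beta_l^*\lambda)$ if $n>0$ and $\beta_lf:=0$ if $n=0$, and $\beta_l^*f\in\mathcal{F}(\Lambda_{n+1})$ be $(\beta_l^*f)(\lambda):=[m_l(\lambda)]f(\beta_l\lambda)$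 if $m_l(\lambda)>0$ and $(\beta_l^*f)(\lambda):=0$ otherwise. Let $a_l:=\beta_{l+1}^*\beta_l$ and $a_l^*:=\beta_{l+1}\beta_l^*$. For a partition $\eta=(\eta_1\ge\cdots\ge\eta_p\ge 1)$ let $$m_\eta(a):=\sum_{c}\ \sum_{l_1<\cdots<l_p}a_{l_1}^{c_1}\cdots a_{l_p}^{c_p},\qquad m_\eta(a^*):=\sum_{c}\ \sum_{l_1>\cdots>l_p}(a_{l_1}^*)^{c_1}\cdots (a_{l_p}^*)^{c_p},$$ where $c=(c_1,\dots,c_p)$ runs over the distinct rearrangements of $\eta$ and the $l_i$ over $\mathbb{Z}$; applied to $f$ and evaluated at $\lambda$, these sums have only finitely many nonzero terms. For an integer $r\ge 0$ put $$H_r:=\sum_{|\eta|=r}\frac{m_\eta(a)}{[\eta]!},\qquad H_r^*:=\sum_{|\eta|=r}\frac{m_\eta(a^*)}{[\eta]!},\qquad [\eta]!:=[\eta_1]!\cdots[\eta_p]!,\quad |\eta|:=\eta_1+\cdots+\eta_p,$$ the sums being over all partitions of $r$ (so $H_0=H_0^*=1$). Then all these operators mutually commute on $\mathcal{F}$: $$[H_r,H_{r'}]=0,\qquad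 [H_r^*,H_{r'}^*]=0,\qquad [H_r,H_{r'}^*]=0\qquad\text{for all } r,r'\ge 0.$$ Moreover, for every $n\ge 0$ the $n$-particle subspace $\mathcal{F}(\Lambda_n)$ is invariant under all $H_r$ and $H_r^*$, and the operators restrict to $n$ algebraically independent operators on it: the restrictions of $H_1,\dots,H_n$ to $\mathcal{F}(\Lambda_n)$ are algebraically independent over $\mathbb{C}$, and so are the restrictions of $H_1^*,\dots,H_n^*$; the restrictions of $H_r$ and $H_r^*$ vanish for $r>n$; and the restriction of $H_n$ is invertible, with $H_r^*=H_{n-r}H_n^{-1}$ on $\mathcal{F}(\Lambda_n)$ for $0\le r\le n$. -/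

import Mathlib

noncomputable section

namespace QBoson

/-- The fundamental domain `Λ_n`: weakly decreasing integer `n`-tuples
(`Λ_0` consists of the empty tuple only). -/
def Lam (n : ℕ) : Type := {L : List ℤ // L.length = n ∧ L.Pairwise (· ≥ ·)}

/-- The multiplicity `m_l(λ)`. -/
def mult {n : ℕ} (l : ℤ) (x : Lam n) : ℕ := x.1.count l

/-- `β_l^* λ`: insert a component with value `l`. -/
def ins {n : ℕ} (l : ℤ) (x : Lam n) : Lam (n + 1) :=
  ⟨x.1.orderedInsert (· ≥ ·) l, by rw [List.orderedInsert_length, x.2.1],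
    x.2.2.orderedInsert l _⟩

/-- `β_l λ`: delete a component with value `l` (assuming that there is one). -/
def del {n : ℕ} (l : ℤ) (x : Lam (n + 1)) (h : 0 < mult l x) : Lam n :=
  ⟨x.1.erase l, by
    rw [List.length_erase_of_mem (List.count_pos_iff.mp h), x.2.1, Nat.add_sub_cancel],
    x.2.2.sublist List.erase_sublist⟩

/-- The `n`-particle space `F(Λ_n)` of all complex functions on `Λ_n`. -/
abbrev Sector (n : ℕ) : Type := Lam n → ℂ

/-- The algebraic Fock space `F = ⨁_n F(Λ_n)`. -/
abbrev Fock : Type := DirectSum ℕ Sector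

/-- `F(Λ_n)` as a subspace of `F`. -/
def sector (n : ℕ) : Submodule ℂ Fock := LinearMap.range (DirectSum.lof ℂ ℕ Sector n)

/-- The `q`-number `[m]`. -/
def qnum (q : ℝ) (m : ℕ) : ℂ := (1 - (q : ℂ) ^ m) / (1 - (q : ℂ))

/-- The `q`-factorial `[m]! = [m] [m-1] ⋯ [1]`. -/
def qfact (q : ℝ) (m : ℕ) : ℂ := ∏ k ∈ Finset.range m, qnum q (k + 1)

/-- The annihilation operator `β_l` on `F(Λ_{n+1})`. -/
def annSector (l : ℤ) (n : ℕ) : Sector (n + 1) →ₗ[ℂ] Sector n where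
  toFun f := fun x => f (ins l x)
  map_add' _ _ := rfl
  map_smul' _ _ := rfl

/-- The creation operator `β_l^*` on `F(Λ_n)`. -/
def creSector (q : ℝ) (l : ℤ) (n : ℕ) : Sector n →ₗ[ℂ] Sector (n + 1) where
  toFun f := fun x => if h : 0 < mult l x then qnum q (mult l x) * f (del l x h) else 0
  map_add' f g := by
    funext x
    simp only [Pi.add_apply]
    split_ifs <;> ring
  map_smul' c f := by
    funext x
    simp only [Pi.smul_apply, smul_eq_mul, RingHom.id_apply]
    split_ifs <;> ring

/-- The annihilation operator `β_l` on the Fock space (it kills `F(Λ_0)`). -/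
def ann (l : ℤ) : Module.End ℂ Fock :=
  DirectSum.toModule ℂ ℕ Fock fun n =>
    match n with
    | 0 => 0
    | k + 1 => DirectSum.lof ℂ ℕ Sector k ∘ₗ annSector l k

/-- The creation operator `β_l^*` on the Fock space. -/
def cre (q : ℝ) (l : ℤ) : Module.End ℂ Fock :=
  DirectSum.toModule ℂ ℕ Fock fun n => DirectSum.lof ℂ ℕ Sector (n + 1) ∘ₗ creSector q l n

/-- The hopping operator `a_l = β_{l+1}^* β_l`. -/
def hop (q : ℝ) (l : ℤ) : Module.End ℂ Fock := cre q (l + 1) * ann l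

/-- The hopping operator `a_l^* = β_{l+1} β_l^*`. -/
def hopStar (q : ℝ) (l : ℤ) : Module.End ℂ Fock := ann (l + 1) * cre q l

/-! Pointwise finite sums of operators on the Fock space. -/

/-- A family of operators for which the sum of `(T_i f)(λ)` over `i` has, for given `f` and `λ`,
only finitely many nonzero terms, and whose members map each `F(Λ_n)` to itself. -/
structure PointwiseFinite {ι : Type} (T : ι → Module.End ℂ Fock) : Prop where
  finite : ∀ (f : Fock) (n : ℕ) (x : Lam n), (Function.support fun i => T i f n x).Finite
  sector : ∀ (i : ι) (f : Fock) (n : ℕ), f n = 0 → T i f n = 0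

/-- The function underlying the operator `∑ᵢ T i`. -/
def sumFun {ι : Type} (T : ι → Module.End ℂ Fock) (f : Fock) : Fock :=
  letI : (n : ℕ) → (v : Sector n) → Decidable (v ≠ 0) := fun _ v => Classical.dec (v ≠ 0)
  DirectSum.mk Sector (DFinsupp.support f) fun n x => ∑ᶠ i, T i f n x

theorem sumFun_apply {ι : Type} {T : ι → Module.End ℂ Fock} (hT : PointwiseFinite T)
    (f : Fock) (n : ℕ) (x : Lam n) : sumFun T f n x = ∑ᶠ i, T i f n x := by
  let : (n : ℕ) → (v : Sector n) → Decidable (v ≠ 0) := fun _ v => Classical.dec (v ≠ 0)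
  unfold sumFun
  by_cases hn : f n = 0
  · rw [DirectSum.mk_apply_of_notMem]
    · simp [hT.sector _ f n hn]
    · exact fun h => (DFinsupp.mem_support_iff.mp h) hn
  · rw [DirectSum.mk_apply_of_mem]
    exact DFinsupp.mem_support_iff.mpr hn

/-- The operator `∑ᵢ T i`, with `((∑ᵢ T i) f)(λ) = ∑ᵢ (T i f)(λ)`. -/
def pointwiseSum {ι : Type} (T : ι → Module.End ℂ Fock) (hT : PointwiseFinite T) :
    Module.End ℂ Fock where
  toFun := sumFun T
  map_add' f g := by
    ext n x
    simp only [DirectSum.add_apply, Pi.add_apply, sumFun_apply hT, map_add]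
    exact finsum_add_distrib (hT.finite f n x) (hT.finite g n x)
  map_smul' c f := by
    ext n x
    simp only [DirectSum.smul_apply, Pi.smul_apply, sumFun_apply hT, map_smul, smul_eq_mul,
      RingHom.id_apply]
    exact (mul_finsum _ _).symm

theorem pointwiseSum_apply {ι : Type} {T : ι → Module.End ℂ Fock} (hT : PointwiseFinite T)
    (f : Fock) (n : ℕ) (x : Lam n) : pointwiseSum T hT f n x = ∑ᶠ i, T i f n x :=
  sumFun_apply hT f n x

theorem ann_apply (l : ℤ) (f : Fock) (n : ℕ) : ann l f n = annSector l n (f (n + 1)) := by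
  suffices h : (DirectSum.component ℂ ℕ Sector n) ∘ₗ ann l =
      annSector l n ∘ₗ DirectSum.component ℂ ℕ Sector (n + 1) from LinearMap.congr_fun h f
  refine DirectSum.linearMap_ext ℂ fun k => LinearMap.ext fun g => ?_
  simp only [ann, LinearMap.comp_apply, DirectSum.toModule_lof]
  rcases k with _ | k
  · rw [DirectSum.component.of, dif_neg (by omega)]
    simp
  · simp only [LinearMap.comp_apply, DirectSum.component.of]
    by_cases h : k = n
    · subst h; simp
    · rw [dif_neg h, dif_neg (by omega), map_zero]

theorem cre_apply_zero (q : ℝ) (l : ℤ) (f : Fock) : cre q l f 0 = 0 := by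
  suffices h : (DirectSum.component ℂ ℕ Sector 0) ∘ₗ cre q l = 0 from LinearMap.congr_fun h f
  refine DirectSum.linearMap_ext ℂ fun k => LinearMap.ext fun g => ?_
  simp only [cre, LinearMap.comp_apply, DirectSum.toModule_lof]
  rw [DirectSum.component.of, dif_neg (by omega)]
  simp

theorem cre_apply (q : ℝ) (l : ℤ) (f : Fock) (n : ℕ) :
    cre q l f (n + 1) = creSector q l n (f n) := by
  suffices h : (DirectSum.component ℂ ℕ Sector (n + 1)) ∘ₗ cre q l =
      creSector q l n ∘ₗ DirectSum.component ℂ ℕ Sector n from LinearMap.congr_fun h f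
  refine DirectSum.linearMap_ext ℂ fun k => LinearMap.ext fun g => ?_
  simp only [cre, LinearMap.comp_apply, DirectSum.toModule_lof, DirectSum.component.of]
  by_cases h : k = n
  · subst h; simp
  · rw [dif_neg h, dif_neg (by omega), map_zero]

/-- All components of `x` have absolute value at most `K`. -/
def Within (K : ℤ) {n : ℕ} (x : Lam n) : Prop := ∀ y ∈ x.1, |y| ≤ K

/-- An operator that maps each `F(Λ_n)` to itself and, for `n`-particle configurations of size
at most `K`, involves values at configurations of size at most `K + 1` only. -/
structure Local (A : Module.End ℂ Fock) : Prop where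
  sector : ∀ (f : Fock) (n : ℕ), f n = 0 → A f n = 0
  within : ∀ (f : Fock) (n : ℕ) (x : Lam n) (K : ℤ), Within K x → A f n x ≠ 0 →
    ∃ y : Lam n, Within (K + 1) y ∧ f n y ≠ 0

theorem hop_spec (q : ℝ) (l : ℤ) (f : Fock) (n : ℕ) (x : Lam n) (h : hop q l f n x ≠ 0) :
    l + 1 ∈ x.1 ∧ ∃ y : Lam n, f n y ≠ 0 ∧ ∀ z ∈ y.1, z = l ∨ z ∈ x.1 := by
  rw [hop, Module.End.mul_apply] at h
  rcases n with _ | n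
  · rw [cre_apply_zero] at h
    exact absurd rfl h
  · rw [cre_apply, ann_apply] at h
    simp only [creSector, annSector, LinearMap.coe_mk, AddHom.coe_mk] at h
    split_ifs at h with hm
    · refine ⟨List.count_pos_iff.mp hm, _, right_ne_zero_of_mul h, fun z hz => ?_⟩
      rcases (List.mem_orderedInsert _).mp hz with hz | hz
      · exact Or.inl hz
      · exact Or.inr (List.mem_of_mem_erase hz)
    · exact absurd rfl h

theorem hopStar_spec (q : ℝ) (l : ℤ) (f : Fock) (n : ℕ) (x : Lam n)
    (h : hopStar q l f n x ≠ 0) :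
    l ∈ x.1 ∧ ∃ y : Lam n, f n y ≠ 0 ∧ ∀ z ∈ y.1, z = l + 1 ∨ z ∈ x.1 := by
  rw [hopStar, Module.End.mul_apply, ann_apply, cre_apply] at h
  simp only [creSector, annSector, LinearMap.coe_mk, AddHom.coe_mk] at h
  split_ifs at h with hm
  · have hl : l ∈ x.1 := by
      rcases (List.mem_orderedInsert _).mp (List.count_pos_iff.mp hm) with hz | hz
      · omega
      · exact hz
    refine ⟨hl, _, right_ne_zero_of_mul h, fun z hz => ?_⟩
    exact (List.mem_orderedInsert _).mp (List.mem_of_mem_erase hz)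
  · exact absurd rfl h

theorem hop_local (q : ℝ) (l : ℤ) : Local (hop q l) where
  sector f n h := by
    funext x
    by_contra hx
    obtain ⟨-, y, hy, -⟩ := hop_spec q l f n x hx
    exact hy (by rw [h]; rfl)
  within f n x K hK hx := by
    obtain ⟨hl, y, hy, hz⟩ := hop_spec q l f n x hx
    refine ⟨y, fun z hzy => ?_, hy⟩
    have h1 := abs_le.mp (hK _ hl)
    rcases hz z hzy with rfl | h
    · exact abs_le.mpr (by omega)
    · exact (hK _ h).trans (by omega)

theorem hopStar_local (q : ℝ) (l : ℤ) : Local (hopStar q l) where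
  sector f n h := by
    funext x
    by_contra hx
    obtain ⟨-, y, hy, -⟩ := hopStar_spec q l f n x hx
    exact hy (by rw [h]; rfl)
  within f n x K hK hx := by
    obtain ⟨hl, y, hy, hz⟩ := hopStar_spec q l f n x hx
    refine ⟨y, fun z hzy => ?_, hy⟩
    have h1 := abs_le.mp (hK _ hl)
    rcases hz z hzy with rfl | h
    · exact abs_le.mpr (by omega)
    · exact (hK _ h).trans (by omega)

/-- The ordered product `a_{l_1}^{c_1} ⋯ a_{l_p}^{c_p}` for a list of pairs `(l_i, c_i)`. -/
def word (a : ℤ → Module.End ℂ Fock) (w : List (ℤ × ℕ)) : Module.End ℂ Fock :=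
  (w.map fun u => a u.1 ^ u.2).prod

theorem pow_sector {A : Module.End ℂ Fock} (hA : Local A) (m : ℕ) (f : Fock) (n : ℕ)
    (h : f n = 0) : (A ^ m) f n = 0 := by
  induction m with
  | zero => simpa using h
  | succ m ih => rw [pow_succ', Module.End.mul_apply]; exact hA.sector _ _ ih

theorem pow_within {A : Module.End ℂ Fock} (hA : Local A) (m : ℕ) (f : Fock) (n : ℕ)
    (x : Lam n) (K : ℤ) (hK : Within K x) (h : (A ^ m) f n x ≠ 0) :
    ∃ y : Lam n, Within (K + m) y ∧ f n y ≠ 0 := by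
  induction m generalizing K x with
  | zero => exact ⟨x, by simpa using hK, by simpa using h⟩
  | succ m ih =>
    rw [pow_succ', Module.End.mul_apply] at h
    obtain ⟨y, hy, hfy⟩ := hA.within _ n x K hK h
    obtain ⟨z, hz, hfz⟩ := ih y (K + 1) hy hfy
    refine ⟨z, ?_, hfz⟩
    have : K + 1 + (m : ℤ) = K + ((m + 1 : ℕ) : ℤ) := by push_cast; ring
    rwa [this] at hz

theorem word_sector {a : ℤ → Module.End ℂ Fock} (ha : ∀ l, Local (a l)) (w : List (ℤ × ℕ))
    (f : Fock) (n : ℕ) (h : f n = 0) : word a w f n = 0 := by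
  induction w with
  | nil => simpa [word] using h
  | cons u w ih =>
    have : word a (u :: w) = a u.1 ^ u.2 * word a w := by simp [word]
    rw [this, Module.End.mul_apply]
    exact pow_sector (ha _) _ _ _ ih

theorem word_support {a : ℤ → Module.End ℂ Fock} (ha : ∀ l, Local (a l))
    (hl : ∀ (l : ℤ) (f : Fock) (n : ℕ) (x : Lam n) (K : ℤ),
      Within K x → a l f n x ≠ 0 → |l| ≤ K + 1)
    (w : List (ℤ × ℕ)) (hw : ∀ u ∈ w, 0 < u.2) (f : Fock) (n : ℕ) (x : Lam n) (K : ℤ)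
    (hK : Within K x) (h : word a w f n x ≠ 0) :
    ∀ u ∈ w, |u.1| ≤ K + 1 + ((w.map Prod.snd).sum : ℕ) := by
  induction w generalizing K x with
  | nil => simp
  | cons u w ih =>
    have hword : word a (u :: w) = a u.1 ^ u.2 * word a w := by simp [word]
    rw [hword, Module.End.mul_apply] at h
    obtain ⟨y, hy, hfy⟩ := pow_within (ha _) _ _ _ _ K hK h
    have hih := ih (fun v hv => hw v (List.mem_cons_of_mem _ hv)) y (K + u.2) hy hfy
    obtain ⟨m, hm⟩ : ∃ m, u.2 = m + 1 := ⟨u.2 - 1, by have := hw u List.mem_cons_self; omega⟩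
    intro v hv
    simp only [List.map_cons, List.sum_cons, Nat.cast_add]
    rcases List.mem_cons.mp hv with rfl | hv
    · rw [hm, pow_succ', Module.End.mul_apply] at h
      have := hl _ _ _ _ K hK h
      omega
    · have := hih v hv
      omega

theorem exists_within {n : ℕ} (x : Lam n) : ∃ K : ℤ, Within K x := by
  refine ⟨((x.1.map Int.natAbs).sum : ℕ), fun y hy => ?_⟩
  have := List.single_le_sum (l := x.1.map Int.natAbs) (by simp) _ (List.mem_map_of_mem hy)
  rw [Int.abs_eq_natAbs]
  exact_mod_cast this

/-- The list of pairs `(l_i, c_i)`. -/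
def pairs (c : List ℕ) (l : Fin c.length → ℤ) : List (ℤ × ℕ) :=
  List.ofFn fun i => (l i, c.get i)

theorem word_pointwiseFinite {a : ℤ → Module.End ℂ Fock} (ha : ∀ l, Local (a l))
    (hl : ∀ (l : ℤ) (f : Fock) (n : ℕ) (x : Lam n) (K : ℤ),
      Within K x → a l f n x ≠ 0 → |l| ≤ K + 1)
    (c : List ℕ) (hc : ∀ k ∈ c, 0 < k) (P : (Fin c.length → ℤ) → Prop) :
    PointwiseFinite fun l : {l : Fin c.length → ℤ // P l} => word a (pairs c l.1) where
  sector l f n h := word_sector ha _ f n h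
  finite f n x := by
    obtain ⟨K, hK⟩ := exists_within x
    set M : ℤ := K + 1 + ((c.sum : ℕ) : ℤ) with hM
    have hfin : (Set.pi Set.univ fun _ : Fin c.length => Set.Icc (-M) M).Finite :=
      Set.Finite.pi fun _ => Set.finite_Icc _ _
    refine Set.Finite.subset (hfin.preimage (f := Subtype.val) Subtype.val_injective.injOn) ?_
    intro l hlx
    have hpos : ∀ u ∈ pairs c l.1, 0 < u.2 := by
      intro u hu
      obtain ⟨i, rfl⟩ := (List.mem_ofFn' _ _).mp hu
      exact hc _ (List.get_mem _ _)
    have hsum : (pairs c l.1).map Prod.snd = c := by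
      simp only [pairs, List.map_ofFn, Function.comp_def]
      exact List.ofFn_get c
    have := word_support ha hl (pairs c l.1) hpos f n x K hK hlx
    rw [hsum] at this
    intro i _
    have hi := this (l.1 i, c.get i) ((List.mem_ofFn' _ _).mpr ⟨i, rfl⟩)
    exact abs_le.mp hi

theorem hop_pointwiseFinite (q : ℝ) (c : List ℕ) (hc : ∀ k ∈ c, 0 < k) :
    PointwiseFinite fun l : {l : Fin c.length → ℤ // StrictMono l} =>
      word (hop q) (pairs c l.1) := by
  refine word_pointwiseFinite (hop_local q) (fun l f n x K hK h => ?_) c hc _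
  have := abs_le.mp (hK _ (hop_spec q l f n x h).1)
  exact abs_le.mpr (by omega)

theorem hopStar_pointwiseFinite (q : ℝ) (c : List ℕ) (hc : ∀ k ∈ c, 0 < k) :
    PointwiseFinite fun l : {l : Fin c.length → ℤ // StrictAnti l} =>
      word (hopStar q) (pairs c l.1) := by
  refine word_pointwiseFinite (hopStar_local q) (fun l f n x K hK h => ?_) c hc _
  exact (hK _ (hopStar_spec q l f n x h).1).trans (by omega)

/-- The finite set of all distinct compositions obtained by reordering the parts of `η`. -/
def orbit {r : ℕ} (η : Nat.Partition r) : Finset (List ℕ) := (Multiset.lists η.parts).toFinset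

theorem mem_orbit {r : ℕ} (η : Nat.Partition r) (c : List ℕ) :
    c ∈ orbit η ↔ (c : Multiset ℕ) = η.parts := by
  rw [orbit, Multiset.mem_toFinset, Multiset.mem_lists_iff, eq_comm]
  rfl

theorem orbit_pos {r : ℕ} (η : Nat.Partition r) {c : List ℕ} (h : c ∈ orbit η) :
    ∀ k ∈ c, 0 < k := by
  intro k hk
  exact η.parts_pos (by rw [← (mem_orbit η c).mp h]; exact hk)

/-- The hopping operator `m_η(a)`. -/
def monom (q : ℝ) {r : ℕ} (η : Nat.Partition r) : Module.End ℂ Fock :=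
  ∑ c : orbit η, pointwiseSum
    (fun l : {l : Fin c.1.length → ℤ // StrictMono l} => word (hop q) (pairs c.1 l.1))
    (hop_pointwiseFinite q c.1 (orbit_pos η c.2))

/-- The hopping operator `m_η(a^*)`. -/
def monomStar (q : ℝ) {r : ℕ} (η : Nat.Partition r) : Module.End ℂ Fock :=
  ∑ c : orbit η, pointwiseSum
    (fun l : {l : Fin c.1.length → ℤ // StrictAnti l} => word (hopStar q) (pairs c.1 l.1))
    (hopStar_pointwiseFinite q c.1 (orbit_pos η c.2))

/-- `[η]! = [η_1]! ⋯ [η_p]!`. -/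
def qfactPart (q : ℝ) {r : ℕ} (η : Nat.Partition r) : ℂ := (η.parts.map (qfact q)).prod

/-- The operator `H_r`. -/
def H (q : ℝ) (r : ℕ) : Module.End ℂ Fock :=
  ∑ η : Nat.Partition r, (qfactPart q η)⁻¹ • monom q η

/-- The operator `H_r^*`. -/
def HStar (q : ℝ) (r : ℕ) : Module.End ℂ Fock :=
  ∑ η : Nat.Partition r, (qfactPart q η)⁻¹ • monomStar q η

/-- Algebraic independence over `ℂ` of (necessarily commuting) elements of a complex algebra that
need not be commutative: evaluation of polynomials at `T` is a well-defined algebra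
homomorphism, and it is injective. -/
def AlgIndep {ι : Type} {A : Type} [Semiring A] [Algebra ℂ A] (T : ι → A) : Prop :=
  ∃ φ : MvPolynomial ι ℂ →ₐ[ℂ] A, (∀ i, φ (MvPolynomial.X i) = T i) ∧ Function.Injective φ

theorem algIndep_iff {ι : Type} {A : Type} [CommRing A] [Algebra ℂ A] (T : ι → A) :
    AlgIndep T ↔ AlgebraicIndependent ℂ T := by
  constructor
  · rintro ⟨φ, hφ, hinj⟩
    have : φ = MvPolynomial.aeval T := MvPolynomial.algHom_ext fun i => by simp [hφ]
    subst this
    exact hinj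
  · intro h
    exact ⟨MvPolynomial.aeval T, fun i => by simp, h⟩

end QBoson

end

noncomputable section

namespace QBoson

/-! ### `q`-binomial coefficients -/

/-! Evaluating an element of the Fock space at finite multisets of integers turns the operators into
Pieri-type sums. At a multiset `s`, the operator `H q r` sums the function over all ways of lowering
an `r`-element submultiset `t` of `s` by one, weighted by the product over sites `l` of the
`q`-binomial coefficients of `s.count l` and `t.count l`; `HStar q r` is the same with raising
(`evalMultiset_H`, `evalMultiset_HStar`). Indeed, along an ordered word each site is emptied only
once and receives nothing before that, so a power `c` contributes `[c]!` times a `q`-binomial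
coefficient, and the prefactor `1/[η]!` cancels the factorials. Partitions, rearrangements and
positions together enumerate the multisets `t` with `r` elements.

The operators are diagonalised by Hall-Littlewood functions in `n` distinct nonzero variables. These
make sense for arbitrary exponent lists, where lowering `r` entries multiplies by the elementary
symmetric function of the inverse variables. Straightening the lowered lists by `P(…, l-1, l, …) = q
P(…, l, l-1, …)` produces powers of `q` that resum to exactly the `q`-binomial weights
(`lowerSum_eq_pieri`, `pieri_hallLittlewood`).

The `n`-particle space contains all functions, so commutativity is proved dually instead of by
expansion in eigenfunctions. The commutator at `s` is a finite combination of point evaluations; it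
kills every Hall-Littlewood function, and these are linearly independent as functions of the
variables, by sending one variable to infinity (`hallLittlewood_linearIndependent`). Hence it is
zero.

Moving all `n` components is a translation, and raising `r` of them is lowering the other `n - r`
after translating, with equal weights by the symmetry of `q`-binomials (`pieri_pieri_card`). This
gives the relation between the two families, the invertibility of `H_n` and the remaining
commutation relations. Algebraic independence follows from the eigenvalues: they are elementary
symmetric functions of freely chosen distinct nonzero numbers, and the eigenvectors are nonzero
because their value at the origin is `[n]!`. -/

theorem one_sub_ofReal_ne_zero {q : ℝ} (hq1 : q < 1) : (1 - (q : ℂ)) ≠ 0 := by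
  have : (q : ℂ) ≠ 1 := by exact_mod_cast hq1.ne
  exact sub_ne_zero.mpr this.symm

@[simp]
theorem qnum_zero (q : ℝ) : qnum q 0 = 0 := by simp [qnum]

theorem qnum_ne_zero {q : ℝ} (hq0 : 0 < q) (hq1 : q < 1) {m : ℕ} (hm : m ≠ 0) :
    qnum q m ≠ 0 := by
  refine div_ne_zero ?_ (one_sub_ofReal_ne_zero hq1)
  have : (q : ℂ) ^ m ≠ 1 := by exact_mod_cast (pow_lt_one₀ hq0.le hq1 hm).ne
  exact sub_ne_zero.mpr this.symm

theorem qnum_add {q : ℝ} (hq1 : q < 1) (a b : ℕ) :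
    qnum q (a + b) = qnum q a + (q : ℂ) ^ a * qnum q b := by
  have := one_sub_ofReal_ne_zero hq1
  simp only [qnum]
  field_simp
  ring

theorem qnum_succ {q : ℝ} (hq1 : q < 1) (m : ℕ) : qnum q (m + 1) = 1 + q * qnum q m := by
  have := one_sub_ofReal_ne_zero hq1
  simp only [qnum]
  field_simp
  ring

theorem qfact_succ (q : ℝ) (m : ℕ) : qfact q (m + 1) = qfact q m * qnum q (m + 1) :=
  Finset.prod_range_succ _ _

@[simp]
theorem qfact_zero (q : ℝ) : qfact q 0 = 1 := Finset.prod_range_zero _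

theorem qfact_ne_zero {q : ℝ} (hq0 : 0 < q) (hq1 : q < 1) (m : ℕ) : qfact q m ≠ 0 :=
  Finset.prod_ne_zero_iff.mpr fun _ _ => qnum_ne_zero hq0 hq1 (Nat.succ_ne_zero _)

/-- The falling `q`-factorial `[m] [m-1] ⋯ [m-c+1]`. -/
def qfall (q : ℝ) (m c : ℕ) : ℂ := ∏ i ∈ Finset.range c, qnum q (m - i)

@[simp]
theorem qfall_zero (q : ℝ) (m : ℕ) : qfall q m 0 = 1 := Finset.prod_range_zero _

theorem qfall_succ (q : ℝ) (m c : ℕ) : qfall q m (c + 1) = qfall q m c * qnum q (m - c) :=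
  Finset.prod_range_succ _ _

theorem qfall_succ' (q : ℝ) (m c : ℕ) :
    qfall q m (c + 1) = qnum q m * qfall q (m - 1) c := by
  rw [qfall, Finset.prod_range_succ', mul_comm]
  simp only [qfall, Nat.sub_zero]
  congr 1
  exact Finset.prod_congr rfl fun i _ => by congr 1; omega

/-- The factor with index `m` is `[0] = 0`, so truncated subtraction in the later factors does no
harm. -/
theorem qfall_eq_zero (q : ℝ) {m c : ℕ} (h : m < c) : qfall q m c = 0 :=
  Finset.prod_eq_zero (Finset.mem_range.mpr h) (by simp)

theorem qfall_mul_qfact (q : ℝ) {m c : ℕ} (h : c ≤ m) :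
    qfall q m c * qfact q (m - c) = qfact q m := by
  induction c with
  | zero => simp
  | succ c ih =>
    rw [qfall_succ, ← ih (by omega), show m - c = (m - (c + 1)) + 1 by omega, qfact_succ]
    ring

/-- The `q`-binomial coefficient. -/
def qbinom (q : ℝ) (m c : ℕ) : ℂ := qfall q m c / qfact q c

@[simp]
theorem qbinom_zero (q : ℝ) (m : ℕ) : qbinom q m 0 = 1 := by simp [qbinom]

theorem qbinom_eq_zero (q : ℝ) {m c : ℕ} (h : m < c) : qbinom q m c = 0 := by
  simp [qbinom, qfall_eq_zero q h]

theorem qbinom_symm {q : ℝ} (hq0 : 0 < q) (hq1 : q < 1) {m c : ℕ} (h : c ≤ m) :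
    qbinom q m (m - c) = qbinom q m c := by
  have h1 := qfall_mul_qfact q h
  have h2 := qfall_mul_qfact q (Nat.sub_le m c)
  rw [Nat.sub_sub_self h] at h2
  rw [qbinom, qbinom, div_eq_div_iff (qfact_ne_zero hq0 hq1 _) (qfact_ne_zero hq0 hq1 _), h1, h2]

/-- The `q`-Pascal rule, in the form whose power of `q` counts the unchosen elements; this matches
the power produced by straightening a list. For `m < c` the truncated exponent multiplies zero. -/
theorem qbinom_succ_succ {q : ℝ} (hq0 : 0 < q) (hq1 : q < 1) (m c : ℕ) :
    qbinom q (m + 1) (c + 1) = qbinom q m (c + 1) + (q : ℂ) ^ (m - c) * qbinom q m c := by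
  rcases lt_or_ge m c with h | h
  · rw [qbinom_eq_zero q h, qbinom_eq_zero q (by omega), qbinom_eq_zero q (by omega)]
    simp
  · have h1 : qnum q (m + 1) = qnum q (m - c) + (q : ℂ) ^ (m - c) * qnum q (c + 1) := by
      rw [← qnum_add hq1]
      congr 1
      omega
    have h2 := qfact_ne_zero hq0 hq1 c
    have h3 := qnum_ne_zero hq0 hq1 (Nat.succ_ne_zero c)
    simp only [qbinom, qfall_succ' q (m + 1), qfall_succ q m c, qfact_succ, h1,
      Nat.add_sub_cancel]
    simp only [Nat.succ_eq_add_one] at h3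
    field_simp

/-! ### `q`-binomial coefficients of multisets -/

/-- The product of the `q`-binomial coefficients of the multiplicities. -/
def qbinomMultiset (q : ℝ) (s t : Multiset ℤ) : ℂ :=
  ∏ l ∈ t.toFinset, qbinom q (s.count l) (t.count l)

theorem qbinomMultiset_eq_prod (q : ℝ) (s t : Multiset ℤ) {U : Finset ℤ} (h : t.toFinset ⊆ U) :
    qbinomMultiset q s t = ∏ l ∈ U, qbinom q (s.count l) (t.count l) := by
  refine Finset.prod_subset h fun l _ hl => ?_
  rw [Multiset.mem_toFinset, ← Multiset.count_eq_zero] at hl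
  simp [hl]

theorem qbinomMultiset_eq_zero (q : ℝ) {s t : Multiset ℤ} (h : ¬ t ≤ s) :
    qbinomMultiset q s t = 0 := by
  rw [Multiset.le_iff_count] at h
  push Not at h
  obtain ⟨l, hl⟩ := h
  refine Finset.prod_eq_zero (i := l) ?_ (qbinom_eq_zero q hl)
  rw [Multiset.mem_toFinset, ← Multiset.count_pos]
  omega

@[simp]
theorem qbinomMultiset_zero (q : ℝ) (s : Multiset ℤ) : qbinomMultiset q s 0 = 1 := by
  simp [qbinomMultiset]

/-- Passing to the complement of the moved components preserves the weight; this is what links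
raising with lowering. -/
theorem qbinomMultiset_symm {q : ℝ} (hq0 : 0 < q) (hq1 : q < 1) {s t : Multiset ℤ} (h : t ≤ s) :
    qbinomMultiset q s (s - t) = qbinomMultiset q s t := by
  rw [qbinomMultiset_eq_prod q s (s - t) (U := s.toFinset)
      (Multiset.toFinset_subset.mpr (Multiset.subset_of_le (Multiset.sub_le_self _ _))),
    qbinomMultiset_eq_prod q s t (U := s.toFinset)
      (Multiset.toFinset_subset.mpr (Multiset.subset_of_le h))]
  refine Finset.prod_congr rfl fun l _ => ?_
  rw [Multiset.count_sub]
  exact qbinom_symm hq0 hq1 (Multiset.le_iff_count.mp h l)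

theorem qbinomMultiset_self {q : ℝ} (hq0 : 0 < q) (hq1 : q < 1) (s : Multiset ℤ) :
    qbinomMultiset q s s = 1 := by
  simpa using (qbinomMultiset_symm hq0 hq1 (Multiset.zero_le s))

/-- The `q`-Pascal rule at the site `a`; all other sites are unaffected. -/
theorem qbinomMultiset_cons {q : ℝ} (hq0 : 0 < q) (hq1 : q < 1) (a : ℤ) (s t : Multiset ℤ) :
    qbinomMultiset q (a ::ₘ s) t = qbinomMultiset q s t +
      if a ∈ t then (q : ℂ) ^ (s.count a - (t.erase a).count a) * qbinomMultiset q s (t.erase a)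
      else 0 := by
  split_ifs with ha
  · have hU : a ∈ t.toFinset := Multiset.mem_toFinset.mpr ha
    rw [qbinomMultiset_eq_prod q s (t.erase a) (U := t.toFinset)
      (Multiset.toFinset_subset.mpr (Multiset.subset_of_le (Multiset.erase_le _ _)))]
    simp only [qbinomMultiset]
    rw [← Finset.mul_prod_erase _ _ hU, ← Finset.mul_prod_erase _ _ hU,
      ← Finset.mul_prod_erase _ _ hU]
    have h1 : ∏ l ∈ t.toFinset.erase a, qbinom q ((a ::ₘ s).count l) (t.count l) =
        ∏ l ∈ t.toFinset.erase a, qbinom q (s.count l) (t.count l) :=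
      Finset.prod_congr rfl fun l hl => by
        rw [Multiset.count_cons_of_ne (Finset.ne_of_mem_erase hl)]
    have h2 : ∏ l ∈ t.toFinset.erase a, qbinom q (s.count l) ((t.erase a).count l) =
        ∏ l ∈ t.toFinset.erase a, qbinom q (s.count l) (t.count l) :=
      Finset.prod_congr rfl fun l hl => by
        rw [Multiset.count_erase_of_ne (Finset.ne_of_mem_erase hl)]
    obtain ⟨c, hc⟩ : ∃ c, t.count a = c + 1 :=
      ⟨t.count a - 1, by have := Multiset.count_pos.mpr ha; omega⟩
    rw [h1, h2, Multiset.count_cons_self, Multiset.count_erase_self, hc, Nat.add_sub_cancel,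
      qbinom_succ_succ hq0 hq1]
    ring
  · rw [add_zero]
    refine Finset.prod_congr rfl fun l hl => ?_
    rw [Multiset.count_cons_of_ne]
    rintro rfl
    exact ha (Multiset.mem_toFinset.mp hl)

/-! ### Pieri operators on functions of multisets -/

/-- The finite set of submultisets of `s` with `r` elements. -/
def subs (r : ℕ) (s : Multiset ℤ) : Finset (Multiset ℤ) :=
  (Finset.Icc 0 s).filter fun t => t.card = r

theorem mem_subs {r : ℕ} {s t : Multiset ℤ} : t ∈ subs r s ↔ t ≤ s ∧ t.card = r := by
  simp [subs]

/-- Shift the components of the submultiset `t` of `s` by `ε`. -/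
def hopping (ε : ℤ) (s t : Multiset ℤ) : Multiset ℤ := s - t + t.map (· + ε)

theorem card_hopping (ε : ℤ) {s t : Multiset ℤ} (h : t ≤ s) : (hopping ε s t).card = s.card := by
  have := Multiset.card_le_card h
  rw [hopping, Multiset.card_add, Multiset.card_map, Multiset.card_sub h]
  omega

/-- The operator on functions of multisets that shifts `r` components by `ε`, with `q`-binomial
weights. -/
def pieri (q : ℝ) (ε : ℤ) (r : ℕ) : (Multiset ℤ → ℂ) →ₗ[ℂ] (Multiset ℤ → ℂ) where
  toFun φ := fun s => ∑ t ∈ subs r s, qbinomMultiset q s t * φ (hopping ε s t)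
  map_add' φ ψ := by
    funext s
    simp only [Pi.add_apply, mul_add, Finset.sum_add_distrib]
  map_smul' c φ := by
    funext s
    simp only [Pi.smul_apply, smul_eq_mul, RingHom.id_apply, Finset.mul_sum]
    exact Finset.sum_congr rfl fun t _ => by ring

theorem pieri_apply (q : ℝ) (ε : ℤ) (r : ℕ) (φ : Multiset ℤ → ℂ) (s : Multiset ℤ) :
    pieri q ε r φ s = ∑ t ∈ subs r s, qbinomMultiset q s t * φ (hopping ε s t) := rfl

/-- Hopping preserves the number of components, so only values at multisets of the same cardinality
matter. -/
theorem pieri_congr (q : ℝ) (ε : ℤ) (r : ℕ) {φ ψ : Multiset ℤ → ℂ} {n : ℕ}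
    (h : ∀ s, s.card = n → φ s = ψ s) (s : Multiset ℤ) (hs : s.card = n) :
    pieri q ε r φ s = pieri q ε r ψ s := by
  refine Finset.sum_congr rfl fun t ht => ?_
  rw [h _ ((card_hopping ε (mem_subs.mp ht).1).trans hs)]

theorem pieri_eq_zero (q : ℝ) (ε : ℤ) {r : ℕ} (φ : Multiset ℤ → ℂ) {s : Multiset ℤ}
    (h : s.card < r) : pieri q ε r φ s = 0 := by
  refine Finset.sum_eq_zero fun t ht => ?_
  obtain ⟨h1, h2⟩ := mem_subs.mp ht
  have := Multiset.card_le_card h1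
  omega

theorem subs_zero (s : Multiset ℤ) : subs 0 s = {0} := by
  ext t
  rw [mem_subs, Multiset.card_eq_zero, Finset.mem_singleton]
  exact ⟨fun h => h.2, fun h => ⟨h ▸ Multiset.zero_le s, h⟩⟩

theorem subs_card (s : Multiset ℤ) : subs s.card s = {s} := by
  ext t
  rw [mem_subs, Finset.mem_singleton]
  exact ⟨fun h => Multiset.eq_of_le_of_card_le h.1 h.2.ge, fun h => by simp [h]⟩

theorem pieri_zero (q : ℝ) (ε : ℤ) : pieri q ε 0 = LinearMap.id := by
  ext φ s
  rw [pieri_apply, subs_zero, Finset.sum_singleton]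
  simp [hopping]

theorem pieri_card {q : ℝ} (hq0 : 0 < q) (hq1 : q < 1) (ε : ℤ) (φ : Multiset ℤ → ℂ)
    {s : Multiset ℤ} {n : ℕ} (h : s.card = n) : pieri q ε n φ s = φ (s.map (· + ε)) := by
  subst h
  rw [pieri_apply, subs_card, Finset.sum_singleton, qbinomMultiset_self hq0 hq1, hopping]
  simp

/-- Moving `r` components in one direction after a translation in the other direction amounts to
moving the remaining components. -/
theorem pieri_pieri_card {q : ℝ} (hq0 : 0 < q) (hq1 : q < 1) (ε : ℤ) (φ : Multiset ℤ → ℂ)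
    {s : Multiset ℤ} {n r : ℕ} (h : s.card = n) (hr : r ≤ n) :
    pieri q ε r (pieri q (-ε) n φ) s = pieri q (-ε) (n - r) φ s := by
  rw [pieri_apply, pieri_apply]
  refine Finset.sum_bij' (fun t _ => s - t) (fun t _ => s - t) ?_ ?_ ?_ ?_ ?_
  · intro t ht
    obtain ⟨h1, h2⟩ := mem_subs.mp ht
    exact mem_subs.mpr ⟨Multiset.sub_le_self _ _, by rw [Multiset.card_sub h1, h, h2]⟩
  · intro t ht
    obtain ⟨h1, h2⟩ := mem_subs.mp ht
    refine mem_subs.mpr ⟨Multiset.sub_le_self _ _, ?_⟩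
    rw [Multiset.card_sub h1, h, h2]
    omega
  · intro t ht
    exact tsub_tsub_cancel_of_le (mem_subs.mp ht).1
  · intro t ht
    exact tsub_tsub_cancel_of_le (mem_subs.mp ht).1
  · intro t ht
    have ht' := (mem_subs.mp ht).1
    rw [pieri_card hq0 hq1 _ _ ((card_hopping ε ht').trans h), qbinomMultiset_symm hq0 hq1 ht']
    simp only [hopping, Multiset.map_add, Multiset.map_map, tsub_tsub_cancel_of_le ht']
    simp [add_comm]

theorem pieri_map_add (q : ℝ) (ε a : ℤ) (r : ℕ) (φ : Multiset ℤ → ℂ) (s : Multiset ℤ) :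
    pieri q ε r φ (s.map (· + a)) = pieri q ε r (fun t => φ (t.map (· + a))) s := by
  have hinj : Function.Injective fun x : ℤ => x + a := add_left_injective a
  rw [pieri_apply, pieri_apply]
  symm
  refine Finset.sum_bij' (fun t _ => t.map (· + a)) (fun t _ => t.map (· + -a)) ?_ ?_ ?_ ?_ ?_
  · intro t ht
    obtain ⟨h1, h2⟩ := mem_subs.mp ht
    exact mem_subs.mpr ⟨Multiset.map_le_map h1, by rw [Multiset.card_map, h2]⟩
  · intro t ht
    obtain ⟨h1, h2⟩ := mem_subs.mp ht
    refine mem_subs.mpr ⟨?_, by rw [Multiset.card_map, h2]⟩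
    simpa [Multiset.map_map, Function.comp_def] using Multiset.map_le_map (f := (· + -a)) h1
  · intro t _
    simp [Multiset.map_map]
  · intro t _
    simp [Multiset.map_map]
  · intro t ht
    have ht' := (mem_subs.mp ht).1
    obtain ⟨u, rfl⟩ := Multiset.le_iff_exists_add.mp ht'
    congr 1
    · simp only [qbinomMultiset, Multiset.toFinset_map]
      rw [Finset.prod_image fun x _ y _ h => hinj h]
      refine Finset.prod_congr rfl fun l _ => ?_
      rw [Multiset.count_map_eq_count' _ _ hinj, Multiset.count_map_eq_count' _ _ hinj]
    · simp only [hopping, Multiset.map_add, Multiset.map_map, add_tsub_cancel_left,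
        Function.comp_def, add_right_comm]

/-! ### Lowering components of a list -/

/-- The sum of the values of `g` at the lists obtained from `L` by lowering `r` entries by `1`. -/
def lowerSum : ℕ → List ℤ → (List ℤ → ℂ) → ℂ
  | 0, L, g => g L
  | _ + 1, [], _ => 0
  | r + 1, a :: L, g =>
      lowerSum (r + 1) L (fun M => g (a :: M)) + lowerSum r L (fun M => g ((a - 1) :: M))

/-- The exchange relation for adjacent entries `l - 1`, `l` of a list. -/
def Exchange (q : ℝ) (g : List ℤ → ℂ) : Prop :=
  ∀ (p : List ℤ) (l : ℤ) (L : List ℤ),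
    g (p ++ (l - 1) :: l :: L) = q * g (p ++ l :: (l - 1) :: L)

theorem Exchange.cons {q : ℝ} {g : List ℤ → ℂ} (hg : Exchange q g) (a : ℤ) :
    Exchange q fun M => g (a :: M) := fun p l L => hg (a :: p) l L

/-- The entry `a - 1` has to pass every copy of the maximal value `a`, at the cost of one factor `q`
each; then it stands in its sorted position. -/
theorem Exchange.cons_sub_one {q : ℝ} {g : List ℤ → ℂ} (hg : Exchange q g) (a : ℤ) (L : List ℤ)
    (hL : L.Pairwise (· ≥ ·)) (ha : ∀ b ∈ L, b ≤ a) :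
    g ((a - 1) :: L) = (q : ℂ) ^ L.count a * g (L.orderedInsert (· ≥ ·) (a - 1)) := by
  induction L generalizing g with
  | nil => simp
  | cons b L ih =>
    rw [List.pairwise_cons] at hL
    rcases (ha b List.mem_cons_self).eq_or_lt with rfl | hb
    · have h1 := hg [] b L
      simp only [List.nil_append] at h1
      have h2 := ih (hg.cons b) hL.2 fun c hc => ha c (List.mem_cons_of_mem _ hc)
      -- After one exchange the head `b` is absorbed into the function, which still satisfies the
      -- exchange relation.
      rw [h1, h2, List.count_cons_self, List.orderedInsert_cons, if_neg (by omega)]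
      ring
    · have h0 : a ∉ b :: L := by
        intro h
        rcases List.mem_cons.mp h with h | h
        · omega
        · have := hL.1 a h
          omega
      rw [List.count_eq_zero_of_not_mem h0, List.orderedInsert_cons, if_pos (by omega)]
      simp

theorem sort_cons_eq_orderedInsert (a : ℤ) (s : Multiset ℤ) :
    (a ::ₘ s).sort (· ≥ ·) = (s.sort (· ≥ ·)).orderedInsert (· ≥ ·) a := by
  refine List.Perm.eq_of_pairwise' (r := (· ≥ ·)) (Multiset.pairwise_sort _ _)
    ((Multiset.pairwise_sort s _).orderedInsert a _) ?_
  refine List.Perm.trans ?_ (List.perm_orderedInsert _ _ _).symm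
  rw [← Multiset.coe_eq_coe, Multiset.sort_eq, ← Multiset.cons_coe, Multiset.sort_eq]

theorem sort_coe_of_pairwise {L : List ℤ} (hL : L.Pairwise (· ≥ ·)) :
    (L : Multiset ℤ).sort (· ≥ ·) = L :=
  List.Perm.eq_of_pairwise' (r := (· ≥ ·)) (Multiset.pairwise_sort _ _) hL
    (Multiset.coe_eq_coe.mp (Multiset.sort_eq _ _))

theorem hopping_cons_of_le (ε a : ℤ) {s t : Multiset ℤ} (h : t ≤ s) :
    hopping ε (a ::ₘ s) t = a ::ₘ hopping ε s t := by
  rw [hopping, hopping, Multiset.cons_sub_of_le a h, Multiset.cons_add]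

theorem hopping_cons_cons (ε a : ℤ) (s t : Multiset ℤ) :
    hopping ε (a ::ₘ s) (a ::ₘ t) = (a + ε) ::ₘ hopping ε s t := by
  rw [hopping, hopping, Multiset.sub_cons, Multiset.erase_cons_head, Multiset.map_cons,
    Multiset.add_cons]

/-- The two terms of the `q`-Pascal rule separate the case in which the distinguished copy of `a`
stays from the case in which it moves. -/
theorem pieri_succ_cons {q : ℝ} (hq0 : 0 < q) (hq1 : q < 1) (ε a : ℤ) (r : ℕ)
    (φ : Multiset ℤ → ℂ) (s : Multiset ℤ) :
    pieri q ε (r + 1) φ (a ::ₘ s) =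
      (∑ t ∈ subs (r + 1) s, qbinomMultiset q s t * φ (a ::ₘ hopping ε s t)) +
      ∑ t ∈ subs r s, (q : ℂ) ^ (s.count a - t.count a) * qbinomMultiset q s t *
        φ ((a + ε) ::ₘ hopping ε s t) := by
  rw [pieri_apply]
  simp only [qbinomMultiset_cons hq0 hq1, add_mul, Finset.sum_add_distrib]
  congr 1
  · symm
    refine Finset.sum_subset_zero_on_sdiff (fun t ht => ?_) (fun t ht => ?_) fun t ht => ?_
    · obtain ⟨h1, h2⟩ := mem_subs.mp ht
      exact mem_subs.mpr ⟨h1.trans (Multiset.le_cons_self _ _), h2⟩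
    · rw [Finset.mem_sdiff, mem_subs, mem_subs] at ht
      rw [qbinomMultiset_eq_zero q fun h => ht.2 ⟨h, ht.1.2⟩, zero_mul]
    · rw [hopping_cons_of_le ε a (mem_subs.mp ht).1]
  · simp only [ite_mul, zero_mul]
    rw [← Finset.sum_filter]
    refine Finset.sum_bij' (fun t _ => t.erase a) (fun t _ => a ::ₘ t) ?_ ?_ ?_ ?_ ?_
    · intro t ht
      rw [Finset.mem_filter, mem_subs] at ht
      refine mem_subs.mpr ⟨Multiset.erase_le_iff_le_cons.mpr ht.1.1, ?_⟩
      rw [Multiset.card_erase_of_mem ht.2, ht.1.2, Nat.pred_succ]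
    · intro t ht
      obtain ⟨h1, h2⟩ := mem_subs.mp ht
      rw [Finset.mem_filter, mem_subs]
      exact ⟨⟨Multiset.cons_le_cons a h1, by rw [Multiset.card_cons, h2]⟩,
        Multiset.mem_cons_self a t⟩
    · intro t ht
      exact Multiset.cons_erase (Finset.mem_filter.mp ht).2
    · intro t _
      exact Multiset.erase_cons_head a t
    · intro t ht
      have h := Multiset.cons_erase (Finset.mem_filter.mp ht).2
      conv_lhs => rw [← h, hopping_cons_cons]
      simp

/-- Both sides satisfy the same recursion on the largest entry: if it is lowered, straightening
costs `q` for each copy of `a` left behind, which is the power in the `q`-Pascal rule. -/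
theorem lowerSum_eq_pieri {q : ℝ} (hq0 : 0 < q) (hq1 : q < 1) (r : ℕ) (L : List ℤ)
    (hL : L.Pairwise (· ≥ ·)) (g : List ℤ → ℂ) (hg : Exchange q g) :
    lowerSum r L g = pieri q (-1) r (fun s => g (s.sort (· ≥ ·))) (L : Multiset ℤ) := by
  induction L generalizing r g with
  | nil =>
    cases r with
    | zero => simp [lowerSum, pieri_zero]
    | succ r => rw [lowerSum, pieri_eq_zero _ _ _ (by simp)]
  | cons a L ih =>
    cases r with
    | zero => rw [lowerSum, pieri_zero, LinearMap.id_apply, sort_coe_of_pairwise hL]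
    | succ r =>
      rw [List.pairwise_cons] at hL
      have hle : ∀ {t : Multiset ℤ}, t ≤ (L : Multiset ℤ) →
          ∀ b ∈ hopping (-1) (L : Multiset ℤ) t, b ≤ a := by
        intro t ht b hb
        rcases Multiset.mem_add.mp hb with hb | hb
        · exact hL.1 b (Multiset.mem_of_le (Multiset.sub_le_self _ _) hb)
        · obtain ⟨c, hc, rfl⟩ := Multiset.mem_map.mp hb
          have := hL.1 c (Multiset.mem_of_le ht hc)
          omega
      rw [lowerSum, ← Multiset.cons_coe, pieri_succ_cons hq0 hq1, ih _ hL.2 _ (hg.cons a),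
        ih _ hL.2 _ (hg.cons (a - 1)), pieri_apply, pieri_apply]
      congr 1
      · refine Finset.sum_congr rfl fun t ht => ?_
        rw [Multiset.sort_cons _ _ _ (hle (mem_subs.mp ht).1)]
      · refine Finset.sum_congr rfl fun t ht => ?_
        have ht' := (mem_subs.mp ht).1
        -- Lowered components lie strictly below `a`, so only unmoved copies of `a` have to be
        -- passed.
        have h0 : (t.map (· + (-1 : ℤ))).count a = 0 := by
          rw [Multiset.count_eq_zero]
          intro h
          obtain ⟨c, hc, hca⟩ := Multiset.mem_map.mp h
          have := hL.1 c (Multiset.mem_of_le ht' hc)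
          omega
        rw [hg.cons_sub_one a _ (Multiset.pairwise_sort _ _)
          (fun b hb => hle ht' b ((Multiset.mem_sort _).mp hb)),
          ← sort_cons_eq_orderedInsert, ← Multiset.coe_count, Multiset.sort_eq, hopping,
          Multiset.count_add, Multiset.count_sub, h0, add_zero, sub_eq_add_neg]
        ring

/-! ### Hall-Littlewood functions -/

/-- The scattering factor `∏_{y ∈ Y} (z - q y) / (z - y)`. -/
def scatter (q : ℝ) (z : ℂ) (Y : Finset ℂ) : ℂ := ∏ y ∈ Y, (z - q * y) / (z - y)

/-- The Hall-Littlewood function in the variables `Z` with exponents `L`. -/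
def hallLittlewood (q : ℝ) : List ℤ → Finset ℂ → ℂ
  | [], _ => 1
  | a :: L, Z => ∑ z ∈ Z, z ^ a * scatter q z (Z.erase z) * hallLittlewood q L (Z.erase z)

theorem scatter_erase (q : ℝ) (z : ℂ) {y : ℂ} {Y : Finset ℂ} (hy : y ∈ Y) :
    scatter q z Y = (z - q * y) / (z - y) * scatter q z (Y.erase y) :=
  (Finset.mul_prod_erase _ _ hy).symm

theorem sum_sum_erase_eq_zero {Z : Finset ℂ} (D : ℂ → ℂ → ℂ)
    (hD : ∀ z ∈ Z, ∀ y ∈ Z, y ≠ z → D z y = -D y z) :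
    ∑ z ∈ Z, ∑ y ∈ Z.erase z, D z y = 0 := by
  have h : ∑ z ∈ Z, ∑ y ∈ Z.erase z, D z y = -∑ z ∈ Z, ∑ y ∈ Z.erase z, D z y := by
    conv_lhs => rw [Finset.sum_comm' (s' := fun y => Z.erase y) (t' := Z) (by
      intro x y
      simp only [Finset.mem_erase]
      tauto)]
    rw [← Finset.sum_neg_distrib]
    refine Finset.sum_congr rfl fun y hy => ?_
    rw [← Finset.sum_neg_distrib]
    refine Finset.sum_congr rfl fun z hz => ?_
    obtain ⟨h1, h2⟩ := Finset.mem_erase.mp hz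
    exact hD z h2 y hy h1.symm
  exact self_eq_neg.mp h

/-- For the first two variables `z`, `y`, the difference of the two sides is a symmetric expression
times `(y - q z)(z - q y)/(z - y)`. This is antisymmetric, so the sum over ordered pairs vanishes;
deeper positions follow by the recursion. -/
theorem hallLittlewood_exchange (q : ℝ) {Z : Finset ℂ} (hZ : 0 ∉ Z) :
    Exchange q fun L => hallLittlewood q L Z := by
  intro p l L
  simp only
  induction p generalizing Z with
  | nil =>
    simp only [List.nil_append, hallLittlewood, Finset.mul_sum]
    rw [← sub_eq_zero, ← Finset.sum_sub_distrib]
    simp only [← Finset.sum_sub_distrib]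
    refine sum_sum_erase_eq_zero _ fun z hz y hy hyz => ?_
    have hz0 : z ≠ 0 := fun h => hZ (h ▸ hz)
    have hy0 : y ≠ 0 := fun h => hZ (h ▸ hy)
    have h1 : z - y ≠ 0 := sub_ne_zero.mpr hyz.symm
    have h2 : y - z ≠ 0 := sub_ne_zero.mpr hyz
    rw [scatter_erase q z (Finset.mem_erase.mpr ⟨hyz, hy⟩),
      scatter_erase q y (Finset.mem_erase.mpr ⟨hyz.symm, hz⟩), Finset.erase_right_comm (a := y),
      zpow_sub_one₀ hz0, zpow_sub_one₀ hy0]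
    field_simp
    ring
  | cons b p ih =>
    simp only [List.cons_append, hallLittlewood, Finset.mul_sum]
    refine Finset.sum_congr rfl fun z _ => ?_
    rw [ih fun h => hZ (Finset.mem_of_mem_erase h)]
    ring

theorem lowerSum_sum (r : ℕ) (L : List ℤ) (Z : Finset ℂ) (k : ℂ → ℂ) (g : ℂ → List ℤ → ℂ) :
    lowerSum r L (fun M => ∑ z ∈ Z, k z * g z M) = ∑ z ∈ Z, k z * lowerSum r L (g z) := by
  induction L generalizing r g with
  | nil => cases r <;> simp [lowerSum]
  | cons a L ih =>
    cases r with
    | zero => simp [lowerSum]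
    | succ r =>
      simp only [lowerSum]
      rw [ih (r + 1) fun z M => g z (a :: M), ih r fun z M => g z ((a - 1) :: M),
        ← Finset.sum_add_distrib]
      simp only [mul_add]

/-- The elementary symmetric function of the inverses of the elements of `Z`. -/
def esymmInv (r : ℕ) (Z : Finset ℂ) : ℂ := (Z.val.map (·⁻¹)).esymm r

theorem esymmInv_zero (Z : Finset ℂ) : esymmInv 0 Z = 1 := by
  simp [esymmInv, Multiset.esymm]

theorem esymmInv_succ (r : ℕ) {Z : Finset ℂ} {z : ℂ} (hz : z ∈ Z) :
    esymmInv (r + 1) Z = esymmInv (r + 1) (Z.erase z) + z⁻¹ * esymmInv r (Z.erase z) := by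
  have h : Z.val.map (·⁻¹) = z⁻¹ ::ₘ (Z.erase z).val.map (·⁻¹) := by
    rw [Finset.erase_val, ← Multiset.map_cons (·⁻¹), Multiset.cons_erase hz]
  rw [esymmInv, h]
  simp only [Multiset.esymm, Multiset.powersetCard_cons, Multiset.map_add, Multiset.map_map,
    Multiset.sum_add, Function.comp_def, Multiset.prod_cons, Multiset.sum_map_mul_left, esymmInv]

/-- Lowering the exponent of `z` multiplies by `z⁻¹`; splitting on whether the first entry is
lowered reproduces the recursion of the elementary symmetric functions. -/
theorem lowerSum_hallLittlewood (q : ℝ) (r : ℕ) (L : List ℤ) {Z : Finset ℂ} (hZ : 0 ∉ Z)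
    (hL : L.length = Z.card) :
    lowerSum r L (fun M => hallLittlewood q M Z) = esymmInv r Z * hallLittlewood q L Z := by
  induction L generalizing r Z with
  | nil =>
    cases r with
    | zero => simp [lowerSum, esymmInv_zero]
    | succ r =>
      obtain rfl : Z = ∅ := Finset.card_eq_zero.mp hL.symm
      simp [lowerSum, esymmInv, Multiset.esymm, Multiset.powersetCard_zero_right]
  | cons a L ih =>
    cases r with
    | zero => simp [lowerSum, esymmInv_zero]
    | succ r =>
      simp only [lowerSum, hallLittlewood, lowerSum_sum]
      rw [← Finset.sum_add_distrib, Finset.mul_sum]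
      refine Finset.sum_congr rfl fun z hz => ?_
      have hz0 : z ≠ 0 := fun h => hZ (h ▸ hz)
      have h0 : (0 : ℂ) ∉ Z.erase z := fun h => hZ (Finset.mem_of_mem_erase h)
      have hc : L.length = (Z.erase z).card := by
        rw [Finset.card_erase_of_mem hz, ← hL, List.length_cons, Nat.add_sub_cancel]
      rw [ih _ h0 hc, ih _ h0 hc, esymmInv_succ r hz, zpow_sub_one₀ hz0]
      ring

/-- The Hall-Littlewood functions are joint eigenfunctions of the Pieri operators. -/
theorem pieri_hallLittlewood {q : ℝ} (hq0 : 0 < q) (hq1 : q < 1) (r : ℕ) {Z : Finset ℂ}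
    (hZ : 0 ∉ Z) (s : Multiset ℤ) (hs : s.card = Z.card) :
    pieri q (-1) r (fun s => hallLittlewood q (s.sort (· ≥ ·)) Z) s =
      esymmInv r Z * hallLittlewood q (s.sort (· ≥ ·)) Z := by
  have h := lowerSum_eq_pieri hq0 hq1 r (s.sort (· ≥ ·)) (Multiset.pairwise_sort _ _) _
    (hallLittlewood_exchange q hZ)
  rw [Multiset.sort_eq] at h
  rw [← h]
  exact lowerSum_hallLittlewood q r _ hZ (by rw [Multiset.length_sort, hs])

/-! ### The value at the origin -/

open Polynomial in
-- Compare leading coefficients in the Lagrange interpolation of `∏ (X - q y)` at the nodes `Z ∪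
-- {0}`: the node `0` contributes `q ^ n`, with `n` the cardinality of `Z`, and a node `z`
-- contributes `1 - q` times its scattering factor.
theorem sum_scatter {q : ℝ} (hq1 : q < 1) {Z : Finset ℂ} (hZ : 0 ∉ Z) :
    ∑ z ∈ Z, scatter q z (Z.erase z) = qnum q Z.card := by
  have hq := one_sub_ofReal_ne_zero hq1
  set P : ℂ[X] := ∏ y ∈ Z, (X - C ((q : ℂ) * y)) with hP
  have hmonic : P.Monic := monic_prod_X_sub_C _ _
  have hdeg : P.natDegree = Z.card := natDegree_finsetProd_X_sub_C_eq_card _ _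
  have heval : ∀ x, P.eval x = ∏ y ∈ Z, (x - q * y) := fun x => by simp [hP, eval_prod]
  have h := Lagrange.coeff_eq_sum (s := insert 0 Z) (v := fun x : ℂ => x) (P := P)
    (fun x _ y _ h => h) (by
      rw [Finset.card_insert_of_notMem hZ, degree_eq_natDegree hmonic.ne_zero, hdeg]
      exact_mod_cast Nat.lt_succ_self _)
  rw [Finset.card_insert_of_notMem hZ, Nat.add_sub_cancel, ← hdeg, hmonic.coeff_natDegree,
    Finset.sum_insert hZ, Finset.erase_insert hZ] at h
  have h0 : P.eval 0 / ∏ j ∈ Z, (0 - j) = (q : ℂ) ^ Z.card := by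
    rw [heval, ← Finset.prod_div_distrib, ← Finset.prod_const]
    refine Finset.prod_congr rfl fun y hy => ?_
    have : y ≠ 0 := fun h => hZ (h ▸ hy)
    field_simp
    ring
  have h1 : ∀ z ∈ Z, P.eval z / ∏ j ∈ (insert 0 Z).erase z, (z - j) =
      (1 - q) * scatter q z (Z.erase z) := by
    intro z hz
    have hz0 : z ≠ 0 := fun h => hZ (h ▸ hz)
    rw [heval, Finset.erase_insert_of_ne hz0.symm,
      Finset.prod_insert fun h => hZ (Finset.mem_of_mem_erase h), ← Finset.mul_prod_erase _ _ hz,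
      scatter, Finset.prod_div_distrib, mul_div_mul_comm]
    congr 1
    field_simp
    ring
  rw [h0, Finset.sum_congr rfl h1, ← Finset.mul_sum] at h
  rw [qnum, eq_div_iff hq]
  linear_combination -h

theorem hallLittlewood_replicate_zero {q : ℝ} (hq1 : q < 1) (n : ℕ) {Z : Finset ℂ}
    (hZ : 0 ∉ Z) (hn : Z.card = n) : hallLittlewood q (List.replicate n 0) Z = qfact q n := by
  induction n generalizing Z with
  | zero => simp [hallLittlewood]
  | succ n ih =>
    rw [List.replicate_succ, hallLittlewood, qfact_succ, ← hn, ← sum_scatter hq1 hZ,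
      Finset.mul_sum]
    refine Finset.sum_congr rfl fun z hz => ?_
    rw [ih (fun h => hZ (Finset.mem_of_mem_erase h))
      (by rw [Finset.card_erase_of_mem hz, hn, Nat.add_sub_cancel])]
    rw [zpow_zero]
    ring

/-! ### Linear independence -/

open Filter Bornology Topology

theorem tendsto_scatter_cobounded (q : ℝ) (Y : Finset ℂ) :
    Tendsto (fun T : ℂ => scatter q T Y) (cobounded ℂ) (𝓝 1) := by
  have : Tendsto (fun T : ℂ => scatter q T Y) (cobounded ℂ) (𝓝 (∏ _y ∈ Y, (1 : ℂ))) := by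
    refine tendsto_finsetProd _ fun y _ => ?_
    have h : Tendsto (fun T : ℂ => (1 - q * y * T⁻¹) / (1 - y * T⁻¹)) (cobounded ℂ)
        (𝓝 ((1 - q * y * 0) / (1 - y * 0))) :=
      (tendsto_const_nhds.sub (tendsto_inv₀_cobounded.const_mul _)).div
        (tendsto_const_nhds.sub (tendsto_inv₀_cobounded.const_mul _)) (by simp)
    simp only [mul_zero, sub_zero, div_one] at h
    refine h.congr' ?_
    filter_upwards [eventually_ne_cobounded (0 : ℂ)] with T hT
    rw [← mul_div_mul_right _ _ hT, sub_mul, sub_mul, one_mul, mul_assoc (_ * _),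
      mul_assoc y, inv_mul_cancel₀ hT, mul_one, mul_one]
  simpa using this

theorem tendsto_factor_cobounded (q : ℝ) (z : ℂ) :
    Tendsto (fun T : ℂ => (z - q * T) / (z - T)) (cobounded ℂ) (𝓝 q) := by
  have h : Tendsto (fun T : ℂ => (z * T⁻¹ - q) / (z * T⁻¹ - 1)) (cobounded ℂ)
      (𝓝 ((z * 0 - q) / (z * 0 - 1))) :=
    ((tendsto_inv₀_cobounded.const_mul _).sub tendsto_const_nhds).div
      ((tendsto_inv₀_cobounded.const_mul _).sub tendsto_const_nhds) (by simp)
  have h0 : (z * 0 - (q : ℂ)) / (z * 0 - 1) = q := by simp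
  rw [h0] at h
  refine h.congr' ?_
  filter_upwards [eventually_ne_cobounded (0 : ℂ)] with T hT
  rw [← mul_div_mul_right _ _ hT, sub_mul, sub_mul, mul_assoc, inv_mul_cancel₀ hT, one_mul,
    mul_one]

theorem tendsto_zpow_cobounded_zero {k : ℤ} (hk : k < 0) :
    Tendsto (fun T : ℂ => T ^ k) (cobounded ℂ) (𝓝 0) := by
  obtain ⟨m, rfl⟩ : ∃ m : ℕ, k = -((m + 1 : ℕ) : ℤ) := ⟨(-k).toNat - 1, by omega⟩
  have h := (tendsto_inv₀_cobounded (α := ℂ)).pow (m + 1)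
  rw [zero_pow (Nat.succ_ne_zero m)] at h
  refine h.congr fun T => ?_
  rw [zpow_neg, zpow_natCast, inv_pow]

theorem eventually_notMem_cobounded (Z : Finset ℂ) : ∀ᶠ T in cobounded ℂ, T ∉ Z :=
  isBounded_def.mp Z.finite_toSet.isBounded

theorem hallLittlewood_insert (q : ℝ) (b : ℤ) (L : List ℤ) {Z : Finset ℂ} {T : ℂ} (hT : T ∉ Z) :
    hallLittlewood q (b :: L) (insert T Z) = T ^ b * scatter q T Z * hallLittlewood q L Z +
      ∑ z ∈ Z, z ^ b * ((z - q * T) / (z - T) * scatter q z (Z.erase z)) *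
        hallLittlewood q L (insert T (Z.erase z)) := by
  rw [hallLittlewood, Finset.sum_insert hT, Finset.erase_insert hT]
  congr 1
  refine Finset.sum_congr rfl fun z hz => ?_
  have hTz : T ≠ z := fun h => hT (h ▸ hz)
  rw [Finset.erase_insert_of_ne hTz, scatter,
    Finset.prod_insert fun h => hT (Finset.mem_of_mem_erase h)]
  rfl

theorem eq_cons_erase {a : ℤ} {L : List ℤ} (hL : L.Pairwise (· ≥ ·)) (ha : ∀ b ∈ L, b ≤ a)
    (h : a ∈ L) : L = a :: L.erase a := by
  cases L with
  | nil => simp at h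
  | cons b L =>
    rw [List.pairwise_cons] at hL
    obtain rfl : b = a := by
      rcases List.mem_cons.mp h with h | h
      · exact h.symm
      · exact le_antisymm (ha b List.mem_cons_self) (hL.1 a h)
    rw [List.erase_cons_head]

/-- The top-order behaviour as one variable `T` tends to infinity: `T` must take an exponent equal
to `a`, and each entry it lets pass before it costs a factor tending to `q`. If `a` does not occur,
the limit is zero since `[0] = 0`. -/
theorem tendsto_hallLittlewood {q : ℝ} (hq1 : q < 1) (a : ℤ) (L : List ℤ)
    (hL : L.Pairwise (· ≥ ·)) (ha : ∀ b ∈ L, b ≤ a) (Z : Finset ℂ) (hc : L.length = Z.card + 1) :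
    Tendsto (fun T : ℂ => T ^ (-a) * hallLittlewood q L (insert T Z)) (cobounded ℂ)
      (𝓝 (qnum q (L.count a) * hallLittlewood q (L.erase a) Z)) := by
  induction L generalizing Z with
  | nil => simp at hc
  | cons b L ih =>
    have hL' := List.pairwise_cons.mp hL
    have ha' : ∀ b ∈ L, b ≤ a := fun c hc => ha c (List.mem_cons_of_mem _ hc)
    have hlim : Tendsto (fun T : ℂ => T ^ (b - a) * scatter q T Z * hallLittlewood q L Z +
        ∑ z ∈ Z, z ^ b * ((z - q * T) / (z - T) * scatter q z (Z.erase z)) *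
          (T ^ (-a) * hallLittlewood q L (insert T (Z.erase z)))) (cobounded ℂ)
        (𝓝 ((if b = a then 1 else 0) * 1 * hallLittlewood q L Z +
        ∑ z ∈ Z, z ^ b * (q * scatter q z (Z.erase z)) *
          (qnum q (L.count a) * hallLittlewood q (L.erase a) (Z.erase z)))) := by
      refine Tendsto.add (((?_ : Tendsto _ _ _).mul (tendsto_scatter_cobounded q Z)).mul
        tendsto_const_nhds) (tendsto_finsetSum _ fun z hz => ?_)
      · split_ifs with hab
        · simp [hab]
        · have := ha b List.mem_cons_self
          exact tendsto_zpow_cobounded_zero (by omega)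
      · refine (((tendsto_factor_cobounded q z).mul_const _).const_mul _).mul
          (ih hL'.2 ha' _ ?_)
        have := Finset.card_pos.mpr ⟨z, hz⟩
        rw [List.length_cons] at hc
        rw [Finset.card_erase_of_mem hz]
        omega
    have hval : (if b = a then 1 else 0) * 1 * hallLittlewood q L Z +
        ∑ z ∈ Z, z ^ b * (q * scatter q z (Z.erase z)) *
          (qnum q (L.count a) * hallLittlewood q (L.erase a) (Z.erase z)) =
        qnum q ((b :: L).count a) * hallLittlewood q ((b :: L).erase a) Z := by
      by_cases hab : b = a
      -- Here `T` in the first slot contributes `1` and `T` further back contributes `q [m]`, adding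
      -- up to `[m + 1]`.
      · subst hab
        rw [if_pos rfl, List.count_cons_self, List.erase_cons_head, qnum_succ hq1, add_mul,
          one_mul]
        congr 1
        by_cases hm : b ∈ L
        · conv_rhs => rw [eq_cons_erase hL'.2 ha' hm]
          rw [hallLittlewood, Finset.mul_sum, ← eq_cons_erase hL'.2 ha' hm]
          exact Finset.sum_congr rfl fun z _ => by ring
        · simp [List.count_eq_zero_of_not_mem hm]
      · have h0 : a ∉ L := fun h => by
          have h1 := hL'.1 a h
          have h2 := ha b List.mem_cons_self
          omega
        simp [hab, List.count_eq_zero_of_not_mem h0]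
    rw [hval] at hlim
    refine hlim.congr' ?_
    filter_upwards [eventually_ne_cobounded (0 : ℂ), eventually_notMem_cobounded Z] with T hT hTZ
    rw [hallLittlewood_insert q b L hTZ, mul_add, sub_eq_neg_add, zpow_add₀ hT, Finset.mul_sum]
    congr 1
    · ring
    · exact Finset.sum_congr rfl fun z _ => by ring

/-- The Hall-Littlewood functions in `n` variables with weakly decreasing exponents are linearly
independent. -/
theorem hallLittlewood_linearIndependent {q : ℝ} (hq0 : 0 < q) (hq1 : q < 1) (n : ℕ)
    (S : Finset (List ℤ)) (hS : ∀ L ∈ S, L.length = n ∧ L.Pairwise (· ≥ ·)) (d : List ℤ → ℂ)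
    (h : ∀ Z : Finset ℂ, 0 ∉ Z → Z.card = n → ∑ L ∈ S, d L * hallLittlewood q L Z = 0) :
    ∀ L ∈ S, d L = 0 := by
  induction n generalizing S d with
  | zero =>
    intro L hL
    have hnil : ∀ M ∈ S, M = [] := fun M hM => List.length_eq_zero_iff.mp (hS M hM).1
    obtain rfl := hnil L hL
    have hS' : S = {[]} := Finset.eq_singleton_iff_unique_mem.mpr ⟨hL, hnil⟩
    have := h ∅ (Finset.notMem_empty _) rfl
    simpa [hS', hallLittlewood] using this
  | succ n ih =>
    by_contra hne
    push Not at hne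
    obtain ⟨L₀, hL₀, hd₀⟩ := hne
    -- Zero coefficients are discarded first, so that the list attaining the largest first entry `a`
    -- has a nonzero coefficient. Dividing by `T ^ a` and letting `T` tend to infinity leaves a
    -- relation in one variable fewer among the lists containing `a`.
    set S₁ := S.filter fun L => d L ≠ 0 with hS₁
    have hS₁mem : ∀ {L}, L ∈ S₁ ↔ L ∈ S ∧ d L ≠ 0 := Finset.mem_filter
    obtain ⟨L₁, hL₁, hmax⟩ := Finset.exists_max_image S₁ List.headI ⟨L₀, hS₁mem.mpr ⟨hL₀, hd₀⟩⟩
    set a := L₁.headI with ha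
    have hcons : ∀ {L}, L ∈ S → L = L.headI :: L.tail := by
      intro L hL
      have := (hS L hL).1
      cases L with
      | nil => simp at this
      | cons b L => rfl
    have hle : ∀ L ∈ S₁, ∀ b ∈ L, b ≤ a := by
      intro L hL b hb
      refine le_trans ?_ (hmax L hL)
      have hp := (hS L (hS₁mem.mp hL).1).2
      rw [hcons (hS₁mem.mp hL).1] at hb hp
      rcases List.mem_cons.mp hb with rfl | hb
      · exact le_rfl
      · exact (List.pairwise_cons.mp hp).1 b hb
    set S₂ := S₁.filter fun L => a ∈ L with hS₂
    have hS₂mem : ∀ {L}, L ∈ S₂ ↔ L ∈ S₁ ∧ a ∈ L := Finset.mem_filter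
    have hS₂cons : ∀ {L}, L ∈ S₂ → L = a :: L.erase a := by
      intro L hL
      obtain ⟨h1, h2⟩ := hS₂mem.mp hL
      exact eq_cons_erase (hS L (hS₁mem.mp h1).1).2 (hle L h1) h2
    have hinj : Set.InjOn (fun L : List ℤ => L.erase a) S₂ := by
      intro L hL M hM hLM
      rw [hS₂cons hL, hS₂cons hM]
      exact congrArg _ hLM
    have key := ih (S₂.image fun L => L.erase a) ?_
      (fun M => d (a :: M) * qnum q ((a :: M).count a)) ?_
    · have hL₂ : L₁ ∈ S₂ := by
        refine hS₂mem.mpr ⟨hL₁, ?_⟩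
        rw [hcons (hS₁mem.mp hL₁).1]
        exact List.mem_cons_self
      have h0 := key _ (Finset.mem_image_of_mem _ hL₂)
      rw [← hS₂cons hL₂] at h0
      rcases mul_eq_zero.mp h0 with h0 | h0
      · exact (hS₁mem.mp hL₁).2 h0
      · refine qnum_ne_zero hq0 hq1 ?_ h0
        exact (List.count_pos_iff.mpr (hS₂mem.mp hL₂).2).ne'
    · intro M hM
      obtain ⟨L, hL, rfl⟩ := Finset.mem_image.mp hM
      obtain ⟨h1, h2⟩ := hS₂mem.mp hL
      have h3 := hS L (hS₁mem.mp h1).1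
      exact ⟨by rw [List.length_erase_of_mem h2, h3.1, Nat.add_sub_cancel],
        h3.2.sublist List.erase_sublist⟩
    · intro Z hZ hn
      rw [Finset.sum_image hinj]
      have hlim : Tendsto (fun T : ℂ => ∑ L ∈ S₁, d L *
          (T ^ (-a) * hallLittlewood q L (insert T Z))) (cobounded ℂ)
          (𝓝 (∑ L ∈ S₁, d L * (qnum q (L.count a) * hallLittlewood q (L.erase a) Z))) := by
        refine tendsto_finsetSum _ fun L hL => (tendsto_hallLittlewood hq1 a L ?_ (hle L hL) Z
          ?_).const_mul _
        · exact (hS L (hS₁mem.mp hL).1).2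
        · rw [(hS L (hS₁mem.mp hL).1).1, hn]
      have hzero : ∀ᶠ T in cobounded ℂ, ∑ L ∈ S₁, d L *
          (T ^ (-a) * hallLittlewood q L (insert T Z)) = 0 := by
        filter_upwards [eventually_ne_cobounded (0 : ℂ), eventually_notMem_cobounded Z]
          with T hT hTZ
        have h0 := h (insert T Z) (by
          rw [Finset.mem_insert]
          rintro (h | h)
          · exact hT h.symm
          · exact hZ h) (by rw [Finset.card_insert_of_notMem hTZ, hn])
        rw [hS₁, Finset.sum_filter]
        calc _ = T ^ (-a) * ∑ L ∈ S, d L * hallLittlewood q L (insert T Z) := by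
              rw [Finset.mul_sum]
              refine Finset.sum_congr rfl fun L _ => ?_
              split_ifs with hd
              · ring
              · rw [not_not.mp hd]
                ring
          _ = 0 := by rw [h0, mul_zero]
      have h0 := tendsto_nhds_unique hlim (tendsto_const_nhds.congr' (hzero.mono fun T h => h.symm))
      rw [← h0, hS₂, Finset.sum_filter]
      refine Finset.sum_congr rfl fun L hL => ?_
      split_ifs with haL
      · rw [← hS₂cons (hS₂mem.mpr ⟨hL, haL⟩)]
        ring
      · simp [List.count_eq_zero_of_not_mem haL]

/-! ### Commutativity of the Pieri operators -/

/-- The finite linear combinations of evaluations at multisets of cardinality `n`. -/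
def evaluations (n : ℕ) : Submodule ℂ ((Multiset ℤ → ℂ) →ₗ[ℂ] ℂ) :=
  Submodule.span ℂ ((fun s => LinearMap.proj s) '' {s : Multiset ℤ | s.card = n})

theorem proj_mem_evaluations {n : ℕ} {s : Multiset ℤ} (h : s.card = n) :
    (LinearMap.proj s : (Multiset ℤ → ℂ) →ₗ[ℂ] ℂ) ∈ evaluations n :=
  Submodule.subset_span (Set.mem_image_of_mem _ h)

/-- The sums are finite at each point, so the transposed operators act on finite combinations of
point evaluations. -/
theorem comp_pieri_mem_evaluations (q : ℝ) (ε : ℤ) (r : ℕ) {n : ℕ}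
    {Φ : (Multiset ℤ → ℂ) →ₗ[ℂ] ℂ} (h : Φ ∈ evaluations n) :
    Φ ∘ₗ pieri q ε r ∈ evaluations n := by
  induction h using Submodule.span_induction with
  | mem Φ h =>
    obtain ⟨s, hs, rfl⟩ := h
    have : (LinearMap.proj s : (Multiset ℤ → ℂ) →ₗ[ℂ] ℂ) ∘ₗ pieri q ε r =
        ∑ t ∈ subs r s, qbinomMultiset q s t • LinearMap.proj (hopping ε s t) := by
      ext φ
      simp [pieri_apply]
    rw [this]
    refine Submodule.sum_mem _ fun t ht => Submodule.smul_mem _ _ (proj_mem_evaluations ?_)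
    exact (card_hopping ε (mem_subs.mp ht).1).trans hs
  | zero => simp
  | add Φ Ψ _ _ h1 h2 => rw [LinearMap.add_comp]; exact Submodule.add_mem _ h1 h2
  | smul c Φ _ h => rw [LinearMap.smul_comp]; exact Submodule.smul_mem _ _ h

/-- Vanishing on all Hall-Littlewood functions is a linear relation among them as functions of `Z`,
so every coefficient of the functional is zero. -/
theorem eq_zero_of_mem_evaluations {q : ℝ} (hq0 : 0 < q) (hq1 : q < 1) {n : ℕ}
    {Φ : (Multiset ℤ → ℂ) →ₗ[ℂ] ℂ} (h : Φ ∈ evaluations n)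
    (hΦ : ∀ Z : Finset ℂ, 0 ∉ Z → Z.card = n →
      Φ (fun s => hallLittlewood q (s.sort (· ≥ ·)) Z) = 0) : Φ = 0 := by
  obtain ⟨d, hd, rfl⟩ := (Finsupp.mem_span_image_iff_linearCombination ℂ).mp h
  have key := hallLittlewood_linearIndependent hq0 hq1 n
    (d.support.image fun s => s.sort (· ≥ ·)) (by
      intro L hL
      obtain ⟨s, hs, rfl⟩ := Finset.mem_image.mp hL
      exact ⟨(Multiset.length_sort _).trans ((Finsupp.mem_supported ℂ d).mp hd hs),
        Multiset.pairwise_sort _ _⟩) (fun L => d (L : Multiset ℤ)) (by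
      intro Z hZ hn
      rw [Finset.sum_image fun s _ t _ h => by
        rw [← Multiset.sort_eq s (· ≥ ·), ← Multiset.sort_eq t (· ≥ ·), h]]
      simp only [Multiset.sort_eq]
      have := hΦ Z hZ hn
      rw [Finsupp.linearCombination_apply, Finsupp.sum, LinearMap.sum_apply] at this
      simpa using this)
  have hd0 : d = 0 := by
    ext s
    by_contra hs
    have := key _ (Finset.mem_image_of_mem _ (Finsupp.mem_support_iff.mpr hs))
    rw [Multiset.sort_eq] at this
    exact hs this
  rw [hd0, map_zero]

/-- On a Hall-Littlewood function both orders give the same product of eigenvalues, and such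
functions separate the functionals in `evaluations`. -/
theorem pieri_comm {q : ℝ} (hq0 : 0 < q) (hq1 : q < 1) (r r' : ℕ) (φ : Multiset ℤ → ℂ) :
    pieri q (-1) r (pieri q (-1) r' φ) = pieri q (-1) r' (pieri q (-1) r φ) := by
  funext s
  have hmem : ∀ r r', ((LinearMap.proj s : (Multiset ℤ → ℂ) →ₗ[ℂ] ℂ) ∘ₗ pieri q (-1) r) ∘ₗ
      pieri q (-1) r' ∈ evaluations s.card := fun r r' =>
    comp_pieri_mem_evaluations q (-1) r'
      (comp_pieri_mem_evaluations q (-1) r (proj_mem_evaluations rfl))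
  have hval : ∀ (r r' : ℕ) (Z : Finset ℂ), 0 ∉ Z → Z.card = s.card →
      pieri q (-1) r (pieri q (-1) r' fun s => hallLittlewood q (s.sort (· ≥ ·)) Z) s =
        esymmInv r' Z * (esymmInv r Z * hallLittlewood q (s.sort (· ≥ ·)) Z) := by
    intro r r' Z hZ hn
    rw [pieri_congr q (-1) r (ψ := esymmInv r' Z • fun s => hallLittlewood q (s.sort (· ≥ ·)) Z)
      (fun t ht => pieri_hallLittlewood hq0 hq1 r' hZ t ht) s hn.symm, map_smul, Pi.smul_apply,
      pieri_hallLittlewood hq0 hq1 r hZ s hn.symm, smul_eq_mul]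
  have h0 := eq_zero_of_mem_evaluations hq0 hq1
    (Submodule.sub_mem _ (hmem r r') (hmem r' r)) (by
      intro Z hZ hn
      simp only [LinearMap.sub_apply, LinearMap.comp_apply, LinearMap.proj_apply]
      rw [hval r r' Z hZ hn, hval r' r Z hZ hn]
      ring)
  exact sub_eq_zero.mp (LinearMap.congr_fun h0 φ)

/-- Raising `r` components out of `n` is lowering `n - r` components, up to a translation. -/
theorem pieri_one_eq {q : ℝ} (hq0 : 0 < q) (hq1 : q < 1) (φ : Multiset ℤ → ℂ)
    {s : Multiset ℤ} {n r : ℕ} (h : s.card = n) (hr : r ≤ n) :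
    pieri q 1 r φ s = pieri q (-1) (n - r) (fun t => φ (t.map (· + 1))) s := by
  rw [← pieri_pieri_card hq0 hq1 1 _ h hr]
  refine pieri_congr q 1 r (n := n) (fun t ht => ?_) s h
  rw [pieri_card hq0 hq1 (-1) _ ht]
  simp [Multiset.map_map]

theorem pieri_one_comm {q : ℝ} (hq0 : 0 < q) (hq1 : q < 1) (r r' : ℕ) (φ : Multiset ℤ → ℂ) :
    pieri q 1 r (pieri q 1 r' φ) = pieri q 1 r' (pieri q 1 r φ) := by
  have hzero : ∀ (r r' : ℕ) (s : Multiset ℤ), s.card < r' →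
      pieri q 1 r (pieri q 1 r' φ) s = 0 := by
    intro r r' s h
    rw [pieri_congr q 1 r (ψ := 0) (fun t ht => pieri_eq_zero q 1 φ (ht.trans_lt h)) s rfl,
      map_zero, Pi.zero_apply]
  have hval : ∀ (r r' : ℕ) (s : Multiset ℤ), r ≤ s.card → r' ≤ s.card →
      pieri q 1 r (pieri q 1 r' φ) s = pieri q (-1) (s.card - r) (pieri q (-1) (s.card - r')
        fun t => φ ((t.map (· + 1)).map (· + 1))) s := by
    intro r r' s h h'
    rw [pieri_one_eq hq0 hq1 _ rfl h]
    refine pieri_congr q (-1) _ (n := s.card) (fun t ht => ?_) s rfl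
    rw [pieri_map_add, pieri_one_eq hq0 hq1 _ ht h']
  funext s
  rcases lt_or_ge s.card r with h | h
  · rw [pieri_eq_zero q 1 _ h, hzero r' r s h]
  rcases lt_or_ge s.card r' with h' | h'
  · rw [pieri_eq_zero q 1 _ h', hzero r r' s h']
  rw [hval r r' s h h', hval r' r s h' h, pieri_comm hq0 hq1]

theorem pieri_comm_one {q : ℝ} (hq0 : 0 < q) (hq1 : q < 1) (r r' : ℕ) (φ : Multiset ℤ → ℂ) :
    pieri q (-1) r (pieri q 1 r' φ) = pieri q 1 r' (pieri q (-1) r φ) := by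
  funext s
  rcases lt_or_ge s.card r' with h | h
  · rw [pieri_eq_zero q 1 _ h, pieri_congr q (-1) r (ψ := 0)
      (fun t ht => pieri_eq_zero q 1 φ (ht.trans_lt h)) s rfl, map_zero, Pi.zero_apply]
  · rw [pieri_one_eq hq0 hq1 _ rfl h]
    simp only [pieri_map_add]
    rw [pieri_comm hq0 hq1]
    exact pieri_congr q (-1) r (n := s.card) (fun t ht => pieri_one_eq hq0 hq1 _ ht h) s rfl

theorem esymmInv_eq_sum (r : ℕ) (Z : Finset ℂ) :
    esymmInv r Z = ∑ t ∈ Z.powersetCard r, ∏ z ∈ t, z⁻¹ :=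
  Finset.esymm_map_val _ _ _

theorem esymmInv_card (Z : Finset ℂ) : esymmInv Z.card Z = ∏ z ∈ Z, z⁻¹ := by
  rw [esymmInv_eq_sum, Finset.powersetCard_self, Finset.sum_singleton]

theorem esymm_mul_esymmInv_card {Z : Finset ℂ} (hZ : 0 ∉ Z) {r : ℕ} (hr : r ≤ Z.card) :
    Z.val.esymm r * esymmInv Z.card Z = esymmInv (Z.card - r) Z := by
  have h := Finset.esymm_map_val (fun z : ℂ => z) Z r
  rw [Multiset.map_id'] at h
  rw [h, esymmInv_card, esymmInv_eq_sum, Finset.sum_mul]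
  refine Finset.sum_bij' (fun t _ => Z \ t) (fun t _ => Z \ t) ?_ ?_ ?_ ?_ ?_
  · intro t ht
    rw [Finset.mem_powersetCard] at ht ⊢
    exact ⟨Finset.sdiff_subset, by rw [Finset.card_sdiff_of_subset ht.1, ht.2]⟩
  · intro t ht
    rw [Finset.mem_powersetCard] at ht ⊢
    exact ⟨Finset.sdiff_subset, by rw [Finset.card_sdiff_of_subset ht.1, ht.2]; omega⟩
  · intro t ht
    exact Finset.sdiff_sdiff_eq_self (Finset.mem_powersetCard.mp ht).1
  · intro t ht
    exact Finset.sdiff_sdiff_eq_self (Finset.mem_powersetCard.mp ht).1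
  · intro t ht
    have ht' := (Finset.mem_powersetCard.mp ht).1
    rw [← Finset.prod_sdiff ht', mul_left_comm, ← Finset.prod_mul_distrib,
      Finset.prod_eq_one fun z hz => mul_inv_cancel₀ fun h => hZ (h ▸ ht' hz), mul_one]

/-- Apply `pieri_pieri_card` to the eigenfunction and cancel the translation eigenvalue `∏ z⁻¹`,
which is nonzero. -/
theorem pieri_one_hallLittlewood {q : ℝ} (hq0 : 0 < q) (hq1 : q < 1) {r : ℕ} {Z : Finset ℂ}
    (hZ : 0 ∉ Z) (hr : r ≤ Z.card) (s : Multiset ℤ) (hs : s.card = Z.card) :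
    pieri q 1 r (fun s => hallLittlewood q (s.sort (· ≥ ·)) Z) s =
      Z.val.esymm r * hallLittlewood q (s.sort (· ≥ ·)) Z := by
  have h := pieri_pieri_card hq0 hq1 1 (fun s => hallLittlewood q (s.sort (· ≥ ·)) Z) hs hr
  rw [pieri_congr q 1 r (ψ := esymmInv Z.card Z • fun s => hallLittlewood q (s.sort (· ≥ ·)) Z)
    (fun t ht => pieri_hallLittlewood hq0 hq1 _ hZ t ht) s hs, map_smul, Pi.smul_apply,
    smul_eq_mul, pieri_hallLittlewood hq0 hq1 _ hZ s hs, ← esymm_mul_esymmInv_card hZ hr] at h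
  have h0 : esymmInv Z.card Z ≠ 0 := by
    rw [esymmInv_card]
    exact Finset.prod_ne_zero_iff.mpr fun z hz => inv_ne_zero fun h => hZ (h ▸ hz)
  refine mul_left_cancel₀ h0 (h.trans ?_)
  ring

/-! ### Algebraic independence from joint eigenvectors -/

/-- Commuting operators with enough joint eigenvectors, whose eigenvalues are the elementary
symmetric functions, are algebraically independent. -/
theorem algIndep_of_eigenvectors {V : Type} [AddCommGroup V] [Module ℂ V] {n : ℕ}
    (T : Fin n → Module.End ℂ V) (hT : ∀ i j, T i * T j = T j * T i)
    (hv : ∀ y : Fin n → ℂ, Function.Injective y → (∀ i, y i ≠ 0) → ∃ v : V, v ≠ 0 ∧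
      ∀ i : Fin n, T i v = ((Finset.univ : Finset (Fin n)).val.map y).esymm (i + 1) • v) :
    AlgIndep T := by
  have hcomm : IsMulCommutative (Algebra.adjoin ℂ (Set.range T)) :=
    Algebra.isMulCommutative_adjoin ℂ (by
      rintro _ ⟨i, rfl⟩ _ ⟨j, rfl⟩
      exact hT i j)
  open scoped IsMulCommutative in
  let φ : MvPolynomial (Fin n) ℂ →ₐ[ℂ] Module.End ℂ V :=
    (Algebra.adjoin ℂ (Set.range T)).val.comp
      (MvPolynomial.aeval fun i => ⟨T i, Algebra.subset_adjoin (Set.mem_range_self i)⟩)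
  have hφ : ∀ i, φ (MvPolynomial.X i) = T i := fun i => by simp [φ]
  refine ⟨φ, hφ, (injective_iff_map_eq_zero φ).mpr fun p hp => ?_⟩
  have heig : ∀ (y : Fin n → ℂ) (v : V),
      (∀ i : Fin n, T i v = ((Finset.univ : Finset (Fin n)).val.map y).esymm (i + 1) • v) →
      ∀ p, φ p v = MvPolynomial.eval y (MvPolynomial.aeval
        (fun i : Fin n => MvPolynomial.esymm (Fin n) ℂ (i + 1)) p) • v := by
    intro y v hyv p
    induction p using MvPolynomial.induction_on with
    | C a =>
      rw [← MvPolynomial.algebraMap_eq, AlgHom.commutes, AlgHom.commutes,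
        MvPolynomial.algebraMap_eq, MvPolynomial.eval_C, Module.algebraMap_end_apply]
    | add p p' h h' => rw [map_add, map_add, map_add, LinearMap.add_apply, h, h', add_smul]
    | mul_X p i h =>
      rw [map_mul, map_mul, map_mul, Module.End.mul_apply, hφ, hyv, map_smul, h, smul_smul,
        MvPolynomial.aeval_X, ← MvPolynomial.aeval_esymm_eq_multiset_esymm (Fin n) ℂ, mul_comm,
        MvPolynomial.aeval_eq_eval]
  have hzero : MvPolynomial.aeval
      (fun i : Fin n => MvPolynomial.esymm (Fin n) ℂ (i + 1)) p = 0 := by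
    -- The `i`-th coordinate ranges over the positive integers congruent to `i + 1` modulo `n`:
    -- infinite, pairwise disjoint sets avoiding zero, so every point of the product is an
    -- admissible set of parameters.
    refine MvPolynomial.funext_set
      (fun i : Fin n => Set.range fun k : ℕ => ((i + 1 + k * n : ℕ) : ℂ)) (fun i => ?_) ?_
    · have hn : 0 < n := i.pos
      refine Set.infinite_range_of_injective fun k k' h => ?_
      have h' : (i + 1 + k * n : ℕ) = i + 1 + k' * n := by exact_mod_cast h
      exact Nat.eq_of_mul_eq_mul_right hn (Nat.add_left_cancel h')
    · intro y hy
      have hy' : ∀ i : Fin n, ∃ k : ℕ, ((i + 1 + k * n : ℕ) : ℂ) = y i := fun i =>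
        hy i (Set.mem_univ i)
      choose k hk using hy'
      have hinj : Function.Injective y := by
        intro i j hij
        rw [← hk, ← hk] at hij
        have h1 : (i + 1 + k i * n : ℕ) = j + 1 + k j * n := by exact_mod_cast hij
        have h2 : (i + k i * n : ℕ) = j + k j * n := by omega
        have h3 := congrArg (· % n) h2
        simp only [Nat.add_mul_mod_self_right, Nat.mod_eq_of_lt i.2, Nat.mod_eq_of_lt j.2] at h3
        exact Fin.ext h3
      have hne : ∀ i, y i ≠ 0 := by
        intro i
        rw [← hk]
        exact_mod_cast (show (i + 1 + k i * n : ℕ) ≠ 0 by omega)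
      obtain ⟨v, hv0, hv⟩ := hv y hinj hne
      have := heig y v hv p
      rw [hp, LinearMap.zero_apply] at this
      rw [map_zero]
      exact (smul_eq_zero.mp this.symm).resolve_right hv0
  -- It remains to use that the elementary symmetric polynomials are algebraically independent.
  have hinj := MvPolynomial.esymmAlgHom_injective (σ := Fin n) (n := n) ℂ (by simp)
  refine (injective_iff_map_eq_zero _).mp hinj p (Subtype.ext ?_)
  rw [MvPolynomial.esymmAlgHom_apply, hzero]
  rfl

/-! ### The Fock space as a space of functions of multisets -/

/-- The weakly decreasing rearrangement of a multiset of cardinality `n`. -/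
def ofMultiset {n : ℕ} (s : Multiset ℤ) (h : s.card = n) : Lam n :=
  ⟨s.sort (· ≥ ·), (Multiset.length_sort _).trans h, Multiset.pairwise_sort _ _⟩

theorem ofMultiset_coe {n : ℕ} (x : Lam n) (h : (x.1 : Multiset ℤ).card = n) :
    ofMultiset (x.1 : Multiset ℤ) h = x :=
  Subtype.ext (sort_coe_of_pairwise x.2.2)

/-- Evaluation of an element of the Fock space at a multiset. -/
def evalMultiset : Fock →ₗ[ℂ] (Multiset ℤ → ℂ) where
  toFun g := fun s => g s.card (ofMultiset s rfl)
  map_add' _ _ := rfl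
  map_smul' _ _ := rfl

theorem evalMultiset_eq (g : Fock) {s : Multiset ℤ} {n : ℕ} (h : s.card = n) :
    evalMultiset g s = g n (ofMultiset s h) := by
  subst h
  rfl

theorem evalMultiset_coe (g : Fock) {n : ℕ} (x : Lam n) :
    evalMultiset g (x.1 : Multiset ℤ) = g n x := by
  have h : (x.1 : Multiset ℤ).card = n := x.2.1
  rw [evalMultiset_eq g h, ofMultiset_coe]

theorem evalMultiset_injective : Function.Injective evalMultiset := by
  intro f g h
  ext n x
  rw [← evalMultiset_coe, ← evalMultiset_coe, h]

theorem evalMultiset_ann (l : ℤ) (g : Fock) (s : Multiset ℤ) :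
    evalMultiset (ann l g) s = evalMultiset g (l ::ₘ s) := by
  rw [evalMultiset_eq _ rfl, ann_apply, evalMultiset_eq g (Multiset.card_cons l s)]
  exact congrArg (g (s.card + 1)) (Subtype.ext (sort_cons_eq_orderedInsert l s).symm)

theorem sort_erase (l : ℤ) (s : Multiset ℤ) :
    (s.erase l).sort (· ≥ ·) = (s.sort (· ≥ ·)).erase l := by
  refine List.Perm.eq_of_pairwise' (r := (· ≥ ·)) (Multiset.pairwise_sort _ _)
    ((Multiset.pairwise_sort s _).sublist List.erase_sublist) ?_
  rw [← Multiset.coe_eq_coe, Multiset.sort_eq, ← Multiset.coe_erase, Multiset.sort_eq]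

theorem evalMultiset_cre (q : ℝ) (l : ℤ) (g : Fock) (s : Multiset ℤ) :
    evalMultiset (cre q l g) s = qnum q (s.count l) * evalMultiset g (s.erase l) := by
  obtain ⟨n, hn⟩ : ∃ n, s.card = n := ⟨_, rfl⟩
  cases n with
  | zero =>
    have hl : s.count l = 0 := by rw [Multiset.card_eq_zero.mp hn, Multiset.count_zero]
    rw [evalMultiset_eq _ hn, cre_apply_zero, hl, qnum_zero, zero_mul]
    rfl
  | succ n =>
    have hm : mult l (ofMultiset s hn) = s.count l := by
      rw [mult, ofMultiset, ← Multiset.coe_count, Multiset.sort_eq]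
    rw [evalMultiset_eq _ hn, cre_apply]
    simp only [creSector, LinearMap.coe_mk, AddHom.coe_mk, hm]
    split_ifs with h
    · have hc : (s.erase l).card = n := by
        rw [Multiset.card_erase_of_mem (Multiset.count_pos.mp h), hn, Nat.pred_succ]
      have hdel : del l (ofMultiset s hn) (hm ▸ h) = ofMultiset (s.erase l) hc :=
        Subtype.ext (sort_erase l s).symm
      rw [evalMultiset_eq g hc, hdel]
    · rw [show s.count l = 0 by omega]
      simp

theorem evalMultiset_hop (q : ℝ) (l : ℤ) (g : Fock) (s : Multiset ℤ) :
    evalMultiset (hop q l g) s =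
      qnum q (s.count (l + 1)) * evalMultiset g ((l + 1 + -1) ::ₘ s.erase (l + 1)) := by
  rw [hop, Module.End.mul_apply, evalMultiset_cre, evalMultiset_ann, add_neg_cancel_right]

theorem evalMultiset_hopStar (q : ℝ) (l : ℤ) (g : Fock) (s : Multiset ℤ) :
    evalMultiset (hopStar q l g) s =
      qnum q (s.count l) * evalMultiset g ((l + 1) ::ₘ s.erase l) := by
  rw [hopStar, Module.End.mul_apply, evalMultiset_ann, evalMultiset_cre,
    Multiset.count_cons_of_ne (by omega), Multiset.erase_cons_tail _ (by omega)]

/-! ### Words in the hopping operators -/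

theorem hopping_hopping (ε : ℤ) {s t u : Multiset ℤ} (h : t + u ≤ s) :
    hopping ε (hopping ε s t) u = hopping ε s (t + u) := by
  have hu : u ≤ s - t := le_tsub_of_add_le_left h
  rw [hopping, hopping, hopping, ← tsub_add_eq_add_tsub hu, Multiset.map_add, add_assoc,
    tsub_tsub]

theorem qbinomMultiset_congr (q : ℝ) {s s' t : Multiset ℤ}
    (h : ∀ l ∈ t, s.count l = s'.count l) : qbinomMultiset q s t = qbinomMultiset q s' t :=
  Finset.prod_congr rfl fun l hl => by rw [h l (Multiset.mem_toFinset.mp hl)]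

theorem qbinomMultiset_replicate_add (q : ℝ) (s t : Multiset ℤ) (a : ℤ) (c : ℕ) (ha : a ∉ t) :
    qbinomMultiset q s (Multiset.replicate c a + t) =
      qbinom q (s.count a) c * qbinomMultiset q s t := by
  have ha' : a ∉ t.toFinset := fun h => ha (Multiset.mem_toFinset.mp h)
  rw [qbinomMultiset_eq_prod q s _ (U := insert a t.toFinset), Finset.prod_insert ha',
    Multiset.count_add, Multiset.count_replicate_self, Multiset.count_eq_zero.mpr ha, add_zero]
  · congr 1
    refine Finset.prod_congr rfl fun l hl => ?_
    have hla : a ≠ l := fun h => ha' (h ▸ hl)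
    rw [Multiset.count_add, Multiset.count_replicate, if_neg hla, zero_add]
  · intro l hl
    rw [Multiset.mem_toFinset, Multiset.mem_add] at hl
    rw [Finset.mem_insert, Multiset.mem_toFinset]
    exact hl.imp Multiset.eq_of_mem_replicate id

theorem qfact_mul_qbinom {q : ℝ} (hq0 : 0 < q) (hq1 : q < 1) (m c : ℕ) :
    qfact q c * qbinom q m c = qfall q m c :=
  mul_div_cancel₀ _ (qfact_ne_zero hq0 hq1 c)

/-- Since `ε ≠ 0`, a moved component leaves the site `k`, so successive factors read off `[m]`,
`[m-1]`, and so on. -/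
theorem evalMultiset_pow {q : ℝ} (hq0 : 0 < q) (hq1 : q < 1) {A : Module.End ℂ Fock} {k ε : ℤ}
    (hε : ε ≠ 0) (hA : ∀ (g : Fock) (s : Multiset ℤ), evalMultiset (A g) s =
      qnum q (s.count k) * evalMultiset g ((k + ε) ::ₘ s.erase k))
    (c : ℕ) (g : Fock) (s : Multiset ℤ) :
    evalMultiset ((A ^ c) g) s = qfact q c * qbinom q (s.count k) c *
      evalMultiset g (hopping ε s (Multiset.replicate c k)) := by
  rw [qfact_mul_qbinom hq0 hq1]
  induction c generalizing s with
  | zero => simp [hopping]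
  | succ c ih =>
    rw [pow_succ', Module.End.mul_apply, hA, ih, Multiset.count_cons_of_ne (by omega),
      Multiset.count_erase_self, qfall_succ' q _ c, ← mul_assoc]
    rcases lt_or_ge (s.count k - 1) c with h | h
    · simp [qfall_eq_zero q h]
    · rw [hopping_cons_of_le _ _ (Multiset.le_count_iff_replicate_le.mp
          (by rwa [Multiset.count_erase_self]))]
      congr 2
      rw [hopping, hopping, Multiset.replicate_succ, Multiset.sub_cons, Multiset.map_cons,
        Multiset.add_cons]

/-- The multiset of components moved by a word of hopping operators. -/
def moved (p : ℤ → ℤ) (w : List (ℤ × ℕ)) : Multiset ℤ :=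
  (w.map fun u => Multiset.replicate u.2 (p u.1)).sum

theorem mem_moved {p : ℤ → ℤ} {w : List (ℤ × ℕ)} {l : ℤ} (h : l ∈ moved p w) :
    ∃ u ∈ w, l = p u.1 := by
  induction w with
  | nil => simp [moved] at h
  | cons u w ih =>
    rw [moved, List.map_cons, List.sum_cons, Multiset.mem_add] at h
    rcases h with h | h
    · exact ⟨u, List.mem_cons_self, Multiset.eq_of_mem_replicate h⟩
    · obtain ⟨v, hv, hl⟩ := ih h
      exact ⟨v, List.mem_cons_of_mem _ hv, hl⟩

/-- The leftmost factor acts on the argument first. The condition `hw` says that no later source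
site is an earlier source or target, so all multiplicities may be read off from the original `s`. -/
theorem evalMultiset_word {q : ℝ} (hq0 : 0 < q) (hq1 : q < 1) {a : ℤ → Module.End ℂ Fock}
    {p : ℤ → ℤ} {ε : ℤ} (hε : ε ≠ 0)
    (ha : ∀ (l : ℤ) (g : Fock) (s : Multiset ℤ), evalMultiset (a l g) s =
      qnum q (s.count (p l)) * evalMultiset g ((p l + ε) ::ₘ s.erase (p l)))
    (w : List (ℤ × ℕ))
    (hw : w.Pairwise fun u v => p v.1 ≠ p u.1 ∧ p v.1 ≠ p u.1 + ε)
    (g : Fock) (s : Multiset ℤ) :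
    evalMultiset (word a w g) s = (w.map fun u => qfact q u.2).prod *
      (qbinomMultiset q s (moved p w) * evalMultiset g (hopping ε s (moved p w))) := by
  induction w generalizing s with
  | nil => simp [word, moved, hopping]
  | cons u w ih =>
    rw [List.pairwise_cons] at hw
    have hword : word a (u :: w) = a u.1 ^ u.2 * word a w := by simp [word]
    have hmoved : moved p (u :: w) = Multiset.replicate u.2 (p u.1) + moved p w := by
      simp [moved]
    have hnot : p u.1 ∉ moved p w := fun h => by
      obtain ⟨v, hv, hl⟩ := mem_moved h
      exact (hw.1 v hv).1 hl.symm
    have hcount : ∀ l ∈ moved p w,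
        (hopping ε s (Multiset.replicate u.2 (p u.1))).count l = s.count l := by
      intro l hl
      obtain ⟨v, hv, rfl⟩ := mem_moved hl
      obtain ⟨h1, h2⟩ := hw.1 v hv
      rw [hopping, Multiset.map_replicate, Multiset.count_add, Multiset.count_sub,
        Multiset.count_replicate, Multiset.count_replicate, if_neg h1.symm, if_neg h2.symm]
      rfl
    rw [hword, Module.End.mul_apply, evalMultiset_pow hq0 hq1 hε (ha u.1), ih hw.2,
      qbinomMultiset_congr q hcount, List.map_cons, List.prod_cons]
    by_cases hle : moved p (u :: w) ≤ s
    · rw [hmoved] at hle ⊢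
      rw [hopping_hopping ε hle, qbinomMultiset_replicate_add q s _ _ _ hnot]
      ring
    -- If the moved components do not fit into `s`, the hoppings need not compose, but both sides
    -- carry a vanishing weight.
    · have h0 := qbinomMultiset_eq_zero q hle
      rw [h0, zero_mul, mul_zero]
      rw [hmoved, qbinomMultiset_replicate_add q s _ _ _ hnot] at h0
      linear_combination (qfact q u.2 * (w.map fun u => qfact q u.2).prod *
        evalMultiset g (hopping ε (hopping ε s (Multiset.replicate u.2 (p u.1))) (moved p w))) * h0

/-! ### Multisets and compositions -/

/-- The composition formed by the multiplicities of a multiset, in increasing order of the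
elements. -/
def composition (t : Multiset ℤ) : List ℕ := (t.toFinset.sort (· ≤ ·)).map fun l => t.count l

/-- The multiset with elements `m_i` of multiplicity `c_i`. -/
def configuration (c : List ℕ) (m : Fin c.length → ℤ) : Multiset ℤ :=
  ∑ i, Multiset.replicate (c.get i) (m i)

theorem moved_pairs (p : ℤ → ℤ) (c : List ℕ) (l : Fin c.length → ℤ) :
    moved p (pairs c l) = configuration c (p ∘ l) := by
  rw [moved, pairs, List.map_ofFn, List.sum_ofFn]
  rfl

theorem count_configuration (c : List ℕ) {m : Fin c.length → ℤ} (hm : Function.Injective m)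
    (i : Fin c.length) : (configuration c m).count (m i) = c.get i := by
  rw [configuration, Multiset.count_sum', Finset.sum_eq_single i]
  · rw [Multiset.count_replicate_self]
  · intro j _ hj
    rw [Multiset.count_replicate, if_neg fun h => hj (hm h)]
  · exact fun h => absurd (Finset.mem_univ i) h

theorem sort_toFinset_configuration {c : List ℕ} (hc : ∀ k ∈ c, 0 < k) {m : Fin c.length → ℤ}
    (hm : StrictMono m) : (configuration c m).toFinset.sort (· ≤ ·) = List.ofFn m := by
  have h : (configuration c m).toFinset = Finset.univ.image m := by
    ext l
    rw [Multiset.mem_toFinset, configuration, Multiset.mem_sum, Finset.mem_image]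
    refine ⟨fun ⟨i, hi, hl⟩ => ⟨i, hi, (Multiset.eq_of_mem_replicate hl).symm⟩,
      fun ⟨i, hi, hl⟩ => ⟨i, hi, ?_⟩⟩
    exact Multiset.mem_replicate.mpr ⟨(hc _ (List.get_mem c i)).ne', hl.symm⟩
  have hp : (List.ofFn m).Pairwise (· ≤ ·) := List.pairwise_ofFn.mpr fun _ _ h => hm.monotone h.le
  refine List.Perm.eq_of_pairwise' (r := (· ≤ ·)) (Finset.pairwise_sort _ _) hp ?_
  refine (List.perm_ext_iff_of_nodup (Finset.sort_nodup _ _)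
    (List.nodup_ofFn.mpr hm.injective)).mpr fun l => ?_
  rw [Finset.mem_sort, h, List.mem_ofFn', Finset.mem_image]
  simp

theorem composition_configuration {c : List ℕ} (hc : ∀ k ∈ c, 0 < k) {m : Fin c.length → ℤ}
    (hm : StrictMono m) : composition (configuration c m) = c := by
  rw [composition, sort_toFinset_configuration hc hm, List.map_ofFn]
  conv_rhs => rw [← List.ofFn_get c]
  congr 1
  funext i
  exact count_configuration c hm.injective i

theorem sum_map_sort {M : Type*} [AddCommMonoid M] (S : Finset ℤ) (f : ℤ → M) :
    ((S.sort (· ≤ ·)).map f).sum = ∑ l ∈ S, f l := by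
  rw [← Multiset.sum_coe, ← Multiset.map_coe, Finset.sort_eq]
  rfl

theorem exists_configuration (t : Multiset ℤ) :
    ∃ m : Fin (composition t).length → ℤ, StrictMono m ∧ configuration (composition t) m = t := by
  have hlen : (composition t).length = (t.toFinset.sort (· ≤ ·)).length := List.length_map _
  refine ⟨fun i => (t.toFinset.sort (· ≤ ·)).get (Fin.cast hlen i), ?_, ?_⟩
  · exact fun i j hij => (Finset.sortedLT_sort t.toFinset).strictMono_get hij
  · have h1 : configuration (composition t)
        (fun i => (t.toFinset.sort (· ≤ ·)).get (Fin.cast hlen i)) =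
        ∑ i : Fin (t.toFinset.sort (· ≤ ·)).length,
          (fun l => Multiset.replicate (t.count l) l) (t.toFinset.sort (· ≤ ·))[i.1] := by
      rw [configuration]
      refine Fintype.sum_equiv (finCongr hlen) _ _ fun i => ?_
      have h2 : (composition t).get i = t.count ((t.toFinset.sort (· ≤ ·)).get (Fin.cast hlen i)) :=
        List.getElem_map _
      rw [h2]
      rfl
    rw [h1.trans (Fin.sum_univ_fun_getElem _ fun l => Multiset.replicate (t.count l) l),
      sum_map_sort]
    conv_rhs => rw [← Multiset.toFinset_sum_count_nsmul_eq t]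
    exact Finset.sum_congr rfl fun l _ => (Multiset.nsmul_singleton l _).symm

theorem composition_pos (t : Multiset ℤ) : ∀ k ∈ composition t, 0 < k := by
  intro k hk
  obtain ⟨l, hl, rfl⟩ := List.mem_map.mp hk
  rw [Finset.mem_sort, Multiset.mem_toFinset] at hl
  exact Multiset.count_pos.mpr hl

theorem sum_composition (t : Multiset ℤ) : (composition t).sum = t.card :=
  (sum_map_sort _ _).trans (Multiset.toFinset_sum_count_eq t)

/-- A multiset is determined by its sorted distinct elements and their multiplicities, so strictly
increasing positions with `c` fixed biject with the multisets of composition `c`. -/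
theorem finsum_configuration {c : List ℕ} (hc : ∀ k ∈ c, 0 < k) (X : Multiset ℤ → ℂ)
    (S : Finset (Multiset ℤ)) (hX : ∀ t, t ∉ S → X t = 0) :
    ∑ᶠ m : {m : Fin c.length → ℤ // StrictMono m}, X (configuration c m.1) =
      ∑ t ∈ S, if composition t = c then X t else 0 := by
  have hinj : Function.Injective fun m : {m : Fin c.length → ℤ // StrictMono m} =>
      configuration c m.1 := by
    intro m m' h
    have h' : configuration c m.1 = configuration c m'.1 := h
    refine Subtype.ext (List.ofFn_injective ?_)
    rw [← sort_toFinset_configuration hc m.2, ← sort_toFinset_configuration hc m'.2, h']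
  have hrange : Set.range (fun m : {m : Fin c.length → ℤ // StrictMono m} =>
      configuration c m.1) = {t | composition t = c} := by
    ext t
    constructor
    · rintro ⟨m, rfl⟩
      exact composition_configuration hc m.2
    · rintro rfl
      obtain ⟨m, hm, ht⟩ := exists_configuration t
      exact ⟨⟨m, hm⟩, ht⟩
  rw [← finsum_mem_range hinj (f := X), hrange]
  simp only [Set.mem_ofPred_eq, finsum_eq_if]
  refine finsum_eq_sum_of_support_subset _ fun t ht => ?_
  by_contra hS
  refine ht ?_
  simp only
  split_ifs
  · exact hX t hS
  · rfl

theorem sum_orbit_composition (r : ℕ) (t : Multiset ℤ) (x : ℂ) :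
    ∑ η : Nat.Partition r, ∑ c ∈ orbit η, (if composition t = c then x else 0) =
      if t.card = r then x else 0 := by
  simp only [Finset.sum_ite_eq, mem_orbit]
  split_ifs with h
  · let η : Nat.Partition r :=
      { parts := composition t
        parts_pos := fun {k} hk => composition_pos t k hk
        parts_sum := by rw [Multiset.sum_coe, sum_composition, h] }
    rw [Finset.sum_eq_single η]
    · exact if_pos rfl
    · intro η' _ hη'
      exact if_neg fun h' => hη' (Nat.Partition.ext h'.symm)
    · exact fun h' => absurd (Finset.mem_univ η) h'
  · refine Finset.sum_eq_zero fun η _ => if_neg fun h' => h ?_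
    rw [← sum_composition, ← Multiset.sum_coe, h', η.parts_sum]

/-- Summation over partitions, their rearrangements and increasing sequences of positions is
summation over multisets. -/
theorem sum_partition_orbit (r : ℕ) (X : Multiset ℤ → ℂ) (S : Finset (Multiset ℤ))
    (hX : ∀ t, t ∉ S → X t = 0) :
    ∑ η : Nat.Partition r, ∑ c : orbit η,
      ∑ᶠ m : {m : Fin c.1.length → ℤ // StrictMono m}, X (configuration c.1 m.1) =
      ∑ t ∈ S with t.card = r, X t := by
  have h1 : ∀ η : Nat.Partition r, ∑ c : orbit η,
      ∑ᶠ m : {m : Fin c.1.length → ℤ // StrictMono m}, X (configuration c.1 m.1) =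
      ∑ t ∈ S, ∑ c ∈ orbit η, if composition t = c then X t else 0 := by
    intro η
    rw [Finset.sum_comm, ← Finset.sum_coe_sort (orbit η)]
    exact Finset.sum_congr rfl fun c _ => finsum_configuration (orbit_pos η c.2) X S hX
  rw [Finset.sum_congr rfl fun η _ => h1 η, Finset.sum_comm, Finset.sum_filter]
  exact Finset.sum_congr rfl fun t _ => sum_orbit_composition r t _

/-! ### The operators `H_r` and `H_r^*` on functions of multisets -/

theorem evalMultiset_pointwiseSum {ι : Type} {T : ι → Module.End ℂ Fock} (hT : PointwiseFinite T)
    (g : Fock) (s : Multiset ℤ) :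
    evalMultiset (pointwiseSum T hT g) s = ∑ᶠ i, evalMultiset (T i g) s :=
  pointwiseSum_apply hT g _ _

theorem prod_qfact_pairs (q : ℝ) {r : ℕ} (η : Nat.Partition r) (c : orbit η)
    (l : Fin c.1.length → ℤ) :
    ((pairs c.1 l).map fun u => qfact q u.2).prod = qfactPart q η := by
  rw [qfactPart, ← (mem_orbit η c.1).mp c.2, Multiset.map_coe, Multiset.prod_coe, pairs,
    List.map_ofFn]
  conv_rhs => rw [← List.ofFn_get c.1, List.map_ofFn]
  rfl

theorem qfactPart_ne_zero {q : ℝ} (hq0 : 0 < q) (hq1 : q < 1) {r : ℕ} (η : Nat.Partition r) :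
    qfactPart q η ≠ 0 := by
  refine Multiset.prod_ne_zero fun h => ?_
  obtain ⟨k, -, hk⟩ := Multiset.mem_map.mp h
  exact qfact_ne_zero hq0 hq1 k hk

theorem evalMultiset_H {q : ℝ} (hq0 : 0 < q) (hq1 : q < 1) (r : ℕ) (g : Fock) :
    evalMultiset (H q r g) = pieri q (-1) r (evalMultiset g) := by
  funext s
  set X : Multiset ℤ → ℂ := fun t => qbinomMultiset q s t * evalMultiset g (hopping (-1) s t)
    with hX
  have hX0 : ∀ t, t ∉ Finset.Icc 0 s → X t = 0 := by
    intro t ht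
    have : ¬ t ≤ s := fun h => ht (Finset.mem_Icc.mpr ⟨Multiset.zero_le t, h⟩)
    simp only [hX, qbinomMultiset_eq_zero q this, zero_mul]
  rw [pieri_apply, subs, ← sum_partition_orbit r X _ hX0]
  simp only [H, LinearMap.sum_apply, LinearMap.smul_apply, map_sum, map_smul, Finset.sum_apply,
    Pi.smul_apply, smul_eq_mul, monom, evalMultiset_pointwiseSum]
  refine Finset.sum_congr rfl fun η _ => ?_
  rw [Finset.mul_sum]
  refine Finset.sum_congr rfl fun c _ => ?_
  have hw : ∀ l : {l : Fin c.1.length → ℤ // StrictMono l},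
      evalMultiset (word (hop q) (pairs c.1 l.1) g) s =
        qfactPart q η * X (configuration c.1 fun i => l.1 i + 1) := by
    intro l
    rw [evalMultiset_word hq0 hq1 (p := (· + 1)) (by omega : (-1 : ℤ) ≠ 0)
      (evalMultiset_hop q) _ ?_ g s, prod_qfact_pairs, moved_pairs]
    · rfl
    · refine List.pairwise_ofFn.mpr fun i j hij => ?_
      have := l.2 hij
      simp only
      omega
  rw [finsum_congr hw, ← mul_finsum, inv_mul_cancel_left₀ (qfactPart_ne_zero hq0 hq1 η)]
  refine finsum_eq_of_bijective
    (fun l => ⟨fun i => l.1 i + 1, fun i j hij => add_lt_add_left (l.2 hij) 1⟩) ⟨?_, ?_⟩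
    fun l => rfl
  · intro l l' h
    refine Subtype.ext (funext fun i => ?_)
    have := congrFun (Subtype.ext_iff.mp h) i
    simpa using this
  · intro m
    refine ⟨⟨fun i => m.1 i - 1, fun i j hij => sub_lt_sub_right (m.2 hij) 1⟩, ?_⟩
    exact Subtype.ext (funext fun i => sub_add_cancel _ _)

theorem configuration_neg (c : List ℕ) (m : Fin c.length → ℤ) :
    configuration c (fun i => -m i) = (configuration c m).map (- ·) := by
  rw [configuration, configuration, ← Multiset.coe_mapAddMonoidHom, map_sum]
  simp [Multiset.map_replicate]

/-- The positions now decrease along a word, so negation is used to reduce to the enumeration by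
increasing positions. -/
theorem evalMultiset_HStar {q : ℝ} (hq0 : 0 < q) (hq1 : q < 1) (r : ℕ) (g : Fock) :
    evalMultiset (HStar q r g) = pieri q 1 r (evalMultiset g) := by
  funext s
  set X : Multiset ℤ → ℂ := fun t => qbinomMultiset q s t * evalMultiset g (hopping 1 s t)
    with hX
  have hneg : ∀ t : Multiset ℤ, (t.map (- ·)).map (- ·) = t := fun t => by
    simp [Multiset.map_map]
  have hX0 : ∀ t, t ∉ (Finset.Icc 0 s).image (Multiset.map (- ·)) →
      X (t.map (- ·)) = 0 := by
    intro t ht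
    have : ¬ t.map (- ·) ≤ s := fun h => ht (Finset.mem_image.mpr
      ⟨_, Finset.mem_Icc.mpr ⟨Multiset.zero_le _, h⟩, hneg t⟩)
    simp only [hX, qbinomMultiset_eq_zero q this, zero_mul]
  have hsum : ∑ t ∈ subs r s, X t =
      ∑ t ∈ (Finset.Icc 0 s).image (Multiset.map (- ·)) with t.card = r, X (t.map (- ·)) := by
    rw [Finset.sum_filter, Finset.sum_image (Function.LeftInverse.injective hneg).injOn, subs,
      Finset.sum_filter]
    simp only [hneg, Multiset.card_map]
  rw [pieri_apply, hsum, ← sum_partition_orbit r (fun t => X (t.map (- ·))) _ hX0]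
  simp only [HStar, LinearMap.sum_apply, LinearMap.smul_apply, map_sum, map_smul,
    Finset.sum_apply, Pi.smul_apply, smul_eq_mul, monomStar, evalMultiset_pointwiseSum]
  refine Finset.sum_congr rfl fun η _ => ?_
  rw [Finset.mul_sum]
  refine Finset.sum_congr rfl fun c _ => ?_
  have hw : ∀ l : {l : Fin c.1.length → ℤ // StrictAnti l},
      evalMultiset (word (hopStar q) (pairs c.1 l.1) g) s =
        qfactPart q η * X (configuration c.1 l.1) := by
    intro l
    rw [evalMultiset_word hq0 hq1 (p := id) (by omega : (1 : ℤ) ≠ 0)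
      (evalMultiset_hopStar q) _ ?_ g s, prod_qfact_pairs, moved_pairs]
    · rfl
    · refine List.pairwise_ofFn.mpr fun i j hij => ?_
      have := l.2 hij
      simp only [id]
      omega
  rw [finsum_congr hw, ← mul_finsum, inv_mul_cancel_left₀ (qfactPart_ne_zero hq0 hq1 η)]
  refine finsum_eq_of_bijective
    (fun l => ⟨fun i => -l.1 i, fun i j hij => neg_lt_neg (l.2 hij)⟩) ⟨?_, ?_⟩ fun l => ?_
  · intro l l' h
    refine Subtype.ext (funext fun i => ?_)
    have := congrFun (Subtype.ext_iff.mp h) i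
    simpa using this
  · intro m
    refine ⟨⟨fun i => -m.1 i, fun i j hij => neg_lt_neg (m.2 hij)⟩, ?_⟩
    exact Subtype.ext (funext fun i => neg_neg _)
  · simp only [configuration_neg, hneg]

/-! ### The sectors of the Fock space -/

theorem mem_sector_iff {n : ℕ} {g : Fock} :
    g ∈ sector n ↔ ∀ s : Multiset ℤ, s.card ≠ n → evalMultiset g s = 0 := by
  constructor
  · rintro ⟨v, rfl⟩ s hs
    rw [evalMultiset_eq _ rfl, DirectSum.lof_eq_of, DirectSum.of_eq_of_ne _ _ _ hs]
    rfl
  · intro h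
    refine ⟨g n, ?_⟩
    refine DFinsupp.ext fun m => ?_
    by_cases hm : m = n
    · subst hm
      exact DirectSum.of_eq_same _ _
    · refine (DirectSum.of_eq_of_ne _ _ _ hm).trans (funext fun x => ?_)
      rw [← evalMultiset_coe, h _ fun h' => hm (by rw [← h']; exact x.2.1.symm)]
      rfl

theorem sector_ext {n : ℕ} {g g' : Fock} (hg : g ∈ sector n) (hg' : g' ∈ sector n)
    (h : ∀ s : Multiset ℤ, s.card = n → evalMultiset g s = evalMultiset g' s) : g = g' := by
  refine evalMultiset_injective (funext fun s => ?_)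
  by_cases hs : s.card = n
  · exact h s hs
  · rw [mem_sector_iff.mp hg s hs, mem_sector_iff.mp hg' s hs]

theorem mem_sector_of_pieri {q : ℝ} {ε : ℤ} {r n : ℕ} {f g : Fock}
    (h : evalMultiset g = pieri q ε r (evalMultiset f)) (hf : f ∈ sector n) : g ∈ sector n := by
  refine mem_sector_iff.mpr fun s hs => ?_
  rw [h, pieri_congr q ε r (ψ := 0) (n := s.card)
    (fun t ht => mem_sector_iff.mp hf t (ht.trans_ne hs)) s rfl, map_zero, Pi.zero_apply]

/-- The Hall-Littlewood function in the variables `Z` as an element of `F(Λ_n)`. -/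
def waveFunction (q : ℝ) (n : ℕ) (Z : Finset ℂ) : Fock :=
  DirectSum.lof ℂ ℕ Sector n fun x => hallLittlewood q x.1 Z

theorem waveFunction_mem (q : ℝ) (n : ℕ) (Z : Finset ℂ) : waveFunction q n Z ∈ sector n :=
  LinearMap.mem_range_self _ _

theorem evalMultiset_waveFunction (q : ℝ) {n : ℕ} (Z : Finset ℂ) {s : Multiset ℤ}
    (hs : s.card = n) :
    evalMultiset (waveFunction q n Z) s = hallLittlewood q (s.sort (· ≥ ·)) Z := by
  rw [evalMultiset_eq _ hs, waveFunction, DirectSum.lof_eq_of, DirectSum.of_eq_same]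
  rfl

theorem waveFunction_ne_zero {q : ℝ} (hq0 : 0 < q) (hq1 : q < 1) {n : ℕ} {Z : Finset ℂ}
    (hZ : 0 ∉ Z) (hn : Z.card = n) : waveFunction q n Z ≠ 0 := by
  intro h
  have h1 := evalMultiset_waveFunction q Z (s := (List.replicate n (0 : ℤ) : Multiset ℤ))
    (n := n) (by simp)
  rw [sort_coe_of_pairwise (List.pairwise_replicate.mpr (Or.inr le_rfl)),
    hallLittlewood_replicate_zero hq1 n hZ hn, h, map_zero] at h1
  exact qfact_ne_zero hq0 hq1 n h1.symm

theorem H_waveFunction {q : ℝ} (hq0 : 0 < q) (hq1 : q < 1) (r : ℕ) {n : ℕ} {Z : Finset ℂ}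
    (hZ : 0 ∉ Z) (hn : Z.card = n) :
    H q r (waveFunction q n Z) = esymmInv r Z • waveFunction q n Z := by
  refine sector_ext (mem_sector_of_pieri (evalMultiset_H hq0 hq1 r _) (waveFunction_mem q n Z))
    (Submodule.smul_mem _ _ (waveFunction_mem q n Z)) fun s hs => ?_
  rw [evalMultiset_H hq0 hq1, map_smul, Pi.smul_apply, evalMultiset_waveFunction q Z hs,
    pieri_congr q (-1) r (fun t ht => evalMultiset_waveFunction q Z ht) s hs,
    pieri_hallLittlewood hq0 hq1 r hZ s (hs.trans hn.symm), smul_eq_mul]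

theorem HStar_waveFunction {q : ℝ} (hq0 : 0 < q) (hq1 : q < 1) {r n : ℕ} {Z : Finset ℂ}
    (hZ : 0 ∉ Z) (hn : Z.card = n) (hr : r ≤ n) :
    HStar q r (waveFunction q n Z) = Z.val.esymm r • waveFunction q n Z := by
  refine sector_ext (mem_sector_of_pieri (evalMultiset_HStar hq0 hq1 r _)
    (waveFunction_mem q n Z))
    (Submodule.smul_mem _ _ (waveFunction_mem q n Z)) fun s hs => ?_
  rw [evalMultiset_HStar hq0 hq1, map_smul, Pi.smul_apply, evalMultiset_waveFunction q Z hs,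
    pieri_congr q 1 r (fun t ht => evalMultiset_waveFunction q Z ht) s hs,
    pieri_one_hallLittlewood hq0 hq1 hZ (hr.trans hn.ge) s (hs.trans hn.symm), smul_eq_mul]

theorem val_image_univ {n : ℕ} {y : Fin n → ℂ} (hy : Function.Injective y) :
    (Finset.univ.image y).val = (Finset.univ : Finset (Fin n)).val.map y :=
  Finset.image_val_of_injOn hy.injOn

theorem card_image_univ {n : ℕ} {y : Fin n → ℂ} (hy : Function.Injective y) :
    (Finset.univ.image y).card = n := by
  rw [Finset.card_image_of_injective _ hy, Finset.card_univ, Fintype.card_fin]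

theorem H_commute {q : ℝ} (hq0 : 0 < q) (hq1 : q < 1) (r r' : ℕ) :
    Commute (H q r) (H q r') := by
  refine LinearMap.ext fun g => evalMultiset_injective ?_
  simp only [Module.End.mul_apply, evalMultiset_H hq0 hq1]
  exact pieri_comm hq0 hq1 r r' _

theorem HStar_commute {q : ℝ} (hq0 : 0 < q) (hq1 : q < 1) (r r' : ℕ) :
    Commute (HStar q r) (HStar q r') := by
  refine LinearMap.ext fun g => evalMultiset_injective ?_
  simp only [Module.End.mul_apply, evalMultiset_HStar hq0 hq1]
  exact pieri_one_comm hq0 hq1 r r' _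

theorem H_commute_HStar {q : ℝ} (hq0 : 0 < q) (hq1 : q < 1) (r r' : ℕ) :
    Commute (H q r) (HStar q r') := by
  refine LinearMap.ext fun g => evalMultiset_injective ?_
  simp only [Module.End.mul_apply, evalMultiset_H hq0 hq1, evalMultiset_HStar hq0 hq1]
  exact pieri_comm_one hq0 hq1 r r' _

theorem H_zero {q : ℝ} (hq0 : 0 < q) (hq1 : q < 1) : H q 0 = 1 := by
  refine LinearMap.ext fun g => evalMultiset_injective ?_
  rw [evalMultiset_H hq0 hq1, pieri_zero]
  rfl

theorem HStar_H_of_mem_sector {q : ℝ} (hq0 : 0 < q) (hq1 : q < 1) {n r : ℕ} (hr : r ≤ n)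
    {f : Fock} (hf : f ∈ sector n) : HStar q r (H q n f) = H q (n - r) f := by
  have h1 := mem_sector_of_pieri (evalMultiset_H hq0 hq1 n f) hf
  refine sector_ext (mem_sector_of_pieri (evalMultiset_HStar hq0 hq1 r _) h1)
    (mem_sector_of_pieri (evalMultiset_H hq0 hq1 (n - r) f) hf) fun s hs => ?_
  rw [evalMultiset_HStar hq0 hq1, evalMultiset_H hq0 hq1, evalMultiset_H hq0 hq1,
    pieri_pieri_card hq0 hq1 1 _ hs hr]

theorem eq_zero_of_pieri {q : ℝ} {ε : ℤ} {r n : ℕ} (hr : n < r) {f g : Fock}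
    (h : evalMultiset g = pieri q ε r (evalMultiset f)) (hf : f ∈ sector n) : g = 0 := by
  refine sector_ext (mem_sector_of_pieri h hf) (Submodule.zero_mem _) fun s hs => ?_
  rw [h, pieri_eq_zero q ε _ (hs.trans_lt hr), map_zero, Pi.zero_apply]

theorem algIndep_H {q : ℝ} (hq0 : 0 < q) (hq1 : q < 1) (n : ℕ)
    (hH : ∀ r : ℕ, ∀ f ∈ sector n, H q r f ∈ sector n) :
    AlgIndep (A := Module.End ℂ (sector n))
      (fun i : Fin n => (H q (i + 1)).restrict (hH (i + 1))) := by
  refine algIndep_of_eigenvectors (V := sector n)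
    (fun i : Fin n => (H q (i + 1)).restrict (hH (i + 1))) (fun i j => ?_) fun y hy hy0 => ?_
  · refine LinearMap.ext fun f => Subtype.ext ?_
    exact LinearMap.congr_fun (H_commute hq0 hq1 (i + 1) (j + 1)) f.1
  · have hinj : Function.Injective fun i => (y i)⁻¹ := inv_injective.comp hy
    -- The eigenvalues of `H` are symmetric functions of the inverse variables, hence the choice of
    -- the inverses of `y` as variables.
    have hZ : (0 : ℂ) ∉ Finset.univ.image fun i => (y i)⁻¹ := by simpa using hy0
    have hZn := card_image_univ hinj
    refine ⟨⟨waveFunction q n (Finset.univ.image fun i => (y i)⁻¹), waveFunction_mem q n _⟩,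
      fun h => waveFunction_ne_zero hq0 hq1 hZ hZn (Subtype.ext_iff.mp h), fun i =>
      Subtype.ext ?_⟩
    refine (H_waveFunction hq0 hq1 (i + 1) hZ hZn).trans ?_
    rw [esymmInv, val_image_univ hinj, Multiset.map_map]
    simp only [Function.comp_def, inv_inv]
    rfl

theorem algIndep_HStar {q : ℝ} (hq0 : 0 < q) (hq1 : q < 1) (n : ℕ)
    (hS : ∀ r : ℕ, ∀ f ∈ sector n, HStar q r f ∈ sector n) :
    AlgIndep (A := Module.End ℂ (sector n))
      (fun i : Fin n => (HStar q (i + 1)).restrict (hS (i + 1))) := by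
  refine algIndep_of_eigenvectors (V := sector n)
    (fun i : Fin n => (HStar q (i + 1)).restrict (hS (i + 1))) (fun i j => ?_)
    fun y hy hy0 => ?_
  · refine LinearMap.ext fun f => Subtype.ext ?_
    exact LinearMap.congr_fun (HStar_commute hq0 hq1 (i + 1) (j + 1)) f.1
  · have hZ : (0 : ℂ) ∉ Finset.univ.image y := by simpa using hy0
    have hZn := card_image_univ hy
    refine ⟨⟨waveFunction q n (Finset.univ.image y), waveFunction_mem q n _⟩,
      fun h => waveFunction_ne_zero hq0 hq1 hZ hZn (Subtype.ext_iff.mp h), fun i =>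
      Subtype.ext ?_⟩
    refine (HStar_waveFunction hq0 hq1 hZ hZn i.2).trans ?_
    rw [val_image_univ hy]
    rfl

/-- The inverse is the restriction of `HStar q n`: the case `r = n` of `HStar_H_of_mem_sector` gives
`H q 0 = 1`, and commutativity supplies the other side. -/
theorem isUnit_H_restrict {q : ℝ} (hq0 : 0 < q) (hq1 : q < 1) (n : ℕ)
    (hH : ∀ f ∈ sector n, H q n f ∈ sector n) (hS : ∀ f ∈ sector n, HStar q n f ∈ sector n) :
    IsUnit ((H q n).restrict hH) := by
  have h : ∀ f ∈ sector n, HStar q n (H q n f) = f := fun f hf => by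
    rw [HStar_H_of_mem_sector hq0 hq1 le_rfl hf, Nat.sub_self, H_zero hq0 hq1,
      Module.End.one_apply]
  refine ⟨⟨(H q n).restrict hH, (HStar q n).restrict hS, ?_, ?_⟩, rfl⟩
  · refine LinearMap.ext fun f => Subtype.ext ?_
    exact (LinearMap.congr_fun (H_commute_HStar hq0 hq1 n n) f.1).trans (h f.1 f.2)
  · exact LinearMap.ext fun f => Subtype.ext (h f.1 f.2)

end QBoson

end

open QBoson in
theorem corollary2 (q : ℝ) (hq0 : 0 < q) (hq1 : q < 1) :
    (∀ r r' : ℕ, Commute (QBoson.H q r) (QBoson.H q r')) ∧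
    (∀ r r' : ℕ, Commute (QBoson.HStar q r) (QBoson.HStar q r')) ∧
    (∀ r r' : ℕ, Commute (QBoson.H q r) (QBoson.HStar q r')) ∧
    ∃ (hH : ∀ n r : ℕ, ∀ f ∈ QBoson.sector n, QBoson.H q r f ∈ QBoson.sector n)
      (hS : ∀ n r : ℕ, ∀ f ∈ QBoson.sector n, QBoson.HStar q r f ∈ QBoson.sector n),
      ∀ n : ℕ,
        QBoson.AlgIndep (A := Module.End ℂ (QBoson.sector n))
          (fun i : Fin n => (QBoson.H q (i + 1)).restrict (hH n (i + 1))) ∧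
        QBoson.AlgIndep (A := Module.End ℂ (QBoson.sector n))
          (fun i : Fin n => (QBoson.HStar q (i + 1)).restrict (hS n (i + 1))) ∧
        (∀ r : ℕ, n < r → (QBoson.H q r).restrict (hH n r) = 0 ∧
          (QBoson.HStar q r).restrict (hS n r) = 0) ∧
        IsUnit ((QBoson.H q n).restrict (hH n n)) ∧
        ∀ r : ℕ, r ≤ n → (QBoson.HStar q r).restrict (hS n r) * (QBoson.H q n).restrict (hH n n) =
          (QBoson.H q (n - r)).restrict (hH n (n - r)) := by
  have hH : ∀ n r : ℕ, ∀ f ∈ sector n, H q r f ∈ sector n := fun n r f hf =>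
    mem_sector_of_pieri (evalMultiset_H hq0 hq1 r f) hf
  have hS : ∀ n r : ℕ, ∀ f ∈ sector n, HStar q r f ∈ sector n := fun n r f hf =>
    mem_sector_of_pieri (evalMultiset_HStar hq0 hq1 r f) hf
  refine ⟨H_commute hq0 hq1, HStar_commute hq0 hq1, H_commute_HStar hq0 hq1, hH, hS, fun n =>
    ⟨algIndep_H hq0 hq1 n (hH n), algIndep_HStar hq0 hq1 n (hS n), fun r hr => ⟨?_, ?_⟩,
      isUnit_H_restrict hq0 hq1 n (hH n n) (hS n n), fun r hr => ?_⟩⟩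
  · exact LinearMap.ext fun f => Subtype.ext
      (eq_zero_of_pieri hr (evalMultiset_H hq0 hq1 r f.1) f.2)
  · exact LinearMap.ext fun f => Subtype.ext
      (eq_zero_of_pieri hr (evalMultiset_HStar hq0 hq1 r f.1) f.2)
  · exact LinearMap.ext fun f => Subtype.ext (HStar_H_of_mem_sector hq0 hq1 hr f.2)
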